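/- Let $n$ be an odd positive integer, and let $\mathcal{S}_n$ be the set of skew-symmetric Littlewood polynomials of degree $n-1$, that is, the polynomials $f(z)=\sum_{j=0}^{n-1}a_jz^j$ with all $a_j\in\{1,-1\}$ such that $f(z)=(-1)^{\frac{n-1}{2}}z^{n-1}f(-z^{-1})$ for all complex $z\neq 0$. Write $\|f\|_4=\left(\frac{1}{2\pi}\int_0^{2\pi}|f(e^{i\theta})|^4\,d\theta\right)^{1/4}$. Let $f$ be drawn uniformly at random from the (finite, non-empty) set $\mathcal{S}_n$. Then $$\mathbb{E}\big(\|f\|_4^4\big)=2n^2-3n+2,$$ $$\operatorname{Var}\big(\|f\|_4^4\big)=\frac{32}{3}n^3-88n^2+\frac{592}{3}n-512\left\lfloor\frac{n-1}{8}\right\rfloor-512\left\lfloor\frac{n-1}{12}\right\rfloor-88+16(-1)^{\frac{n-1}{2}}(n-3).$$ -/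

import Mathlib

open MeasureTheory ProbabilityTheory Polynomial

namespace Littlewood

/-- The `L_p` norm of a polynomial on the complex unit circle, with respect to
normalised arc length. -/
noncomputable def circleNorm (p : ℝ) (f : ℂ[X]) : ℝ :=
  ((2 * Real.pi)⁻¹ *
    ∫ θ in (0 : ℝ)..(2 * Real.pi), ‖f.eval (Complex.exp (Complex.I * θ))‖ ^ p) ^ (1 / p)

/-- The polynomials of degree `n - 1` all of whose coefficients (of `z^0, …, z^(n-1)`)
lie in `{1, -1}`. -/
def littlewoodSet (n : ℕ) : Set ℂ[X] :=
  {f | f.natDegree + 1 = n ∧ ∀ j < n, f.coeff j = 1 ∨ f.coeff j = -1}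

/-- The skew-symmetric Littlewood polynomials of degree `n - 1`. -/
def skewSymmetricSet (n : ℕ) : Set ℂ[X] :=
  {f | f ∈ littlewoodSet n ∧ Odd n ∧
    ∀ z : ℂ, z ≠ 0 → f.eval z = (-1) ^ ((n - 1) / 2) * z ^ (n - 1) * f.eval (-z⁻¹)}

/-- Every set of polynomials is an event; the measure below is supported on a finite set. -/
instance polynomialMeasurableSpace : MeasurableSpace ℂ[X] := ⊤

/-- The uniform distribution on the skew-symmetric Littlewood polynomials of degree `n - 1`. -/
noncomputable def skewUniform (n : ℕ) : Measure ℂ[X] :=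
  uniformOn (skewSymmetricSet n)

end Littlewood

/-! Write n = 2m + 1. Skew-symmetry ties the coefficient at m - t to the one at m + t by the factor
(-1)^t, so putting a_{m+t} = `quarterSign t` * x_{|t|} parametrises the set by m + 1 free signs. On
the unit circle |f(-z)| = |f(z)|, so by Parseval ‖f‖_4^4 is the sum of the squared coefficients of
f(z)f(-z). The odd coefficients vanish; in the even ones the twisting signs factor out, leaving sums
of x_{|t|} x_{|u|} over t + u = 2v. This gives ‖f‖_4^4 = 8m² + 2m + 1 + 8E with E = `centredEnergy
(m + 1) x` (`circleNorm_four_pow_skewPoly`).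

Revealing the signs in order makes E a martingale: x_M enters with a factor D_M = `energyIncrement
M` that involves earlier signs only. Hence E has mean 0, and the mean of E² is the sum over 1 ≤ M ≤
m of the means of D_M² (`signAvg_centredEnergy_sq`).

The cubic terms of D_M come from a + b + c = M with a ≡ M mod 2, as products of the signs at |a|,
|b|, |c|. If b, c have the other parity, a is distinguished and the product arises once; if all
three have the parity of M, each can play the part of a and the product arises three times; a
repeated index leaves a linear term (`energyIncrement_eq`). Orthogonality of sign products turns the
mean of D_M² into lattice point counts: a quadratic polynomial for each parity of M, corrected for
even M when 2 or 3 divides M/2. Summing over M yields the cubic, the two floors and the dependence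
on the parity of m. -/

namespace Littlewood

open Finset

/-! ### Averages over random signs and orthogonality of sign products -/

/-- The sign vector equal to `-1` on `A` and to `1` elsewhere. -/
def signVec (A : Finset ℕ) (j : ℕ) : ℝ := if j ∈ A then -1 else 1

/-- The mean of `F` over independent uniform signs `x 0, …, x (N - 1)`. -/
noncomputable def signAvg (N : ℕ) (F : (ℕ → ℝ) → ℝ) : ℝ :=
  (2 ^ N)⁻¹ * ∑ A ∈ (range N).powerset, F (signVec A)

lemma signVec_sq (A : Finset ℕ) (j : ℕ) : signVec A j ^ 2 = 1 := by
  unfold signVec; split_ifs <;> norm_num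

lemma signVec_mul_self (A : Finset ℕ) (j : ℕ) : signVec A j * signVec A j = 1 := by
  rw [← sq, signVec_sq]

lemma signAvg_congr {N : ℕ} {F F' : (ℕ → ℝ) → ℝ}
    (h : ∀ A ⊆ range N, F (signVec A) = F' (signVec A)) : signAvg N F = signAvg N F' := by
  unfold signAvg
  congr 1
  exact sum_congr rfl fun A hA => h A (mem_powerset.1 hA)

lemma signAvg_add (N : ℕ) (F F' : (ℕ → ℝ) → ℝ) :
    signAvg N (fun x => F x + F' x) = signAvg N F + signAvg N F' := by
  simp only [signAvg, sum_add_distrib, mul_add]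

lemma signAvg_const_mul (N : ℕ) (c : ℝ) (F : (ℕ → ℝ) → ℝ) :
    signAvg N (fun x => c * F x) = c * signAvg N F := by
  simp only [signAvg, ← mul_sum]; ring

lemma signAvg_const (N : ℕ) (c : ℝ) : signAvg N (fun _ => c) = c := by
  simp [signAvg]

lemma signAvg_sum {ι : Type*} (N : ℕ) (I : Finset ι) (F : ι → (ℕ → ℝ) → ℝ) :
    signAvg N (fun x => ∑ t ∈ I, F t x) = ∑ t ∈ I, signAvg N (F t) := by
  simp only [signAvg]
  rw [sum_comm, mul_sum]

lemma signAvg_succ (N : ℕ) (F : (ℕ → ℝ) → ℝ) :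
    signAvg (N + 1) F =
      signAvg N (fun x => (F (Function.update x N 1) + F (Function.update x N (-1))) / 2) := by
  have h1 : ∀ A ⊆ range N, Function.update (signVec A) N 1 = signVec A := by
    intro A hA
    have hN : N ∉ A := fun h => by simpa using hA h
    exact Function.update_eq_self_iff.2 (by simp [signVec, hN])
  have h2 : ∀ A : Finset ℕ, Function.update (signVec A) N (-1) = signVec (insert N A) := by
    intro A
    ext j
    by_cases hj : j = N
    · subst hj; simp [signVec]
    · simp [signVec, hj]
  unfold signAvg
  rw [range_add_one, sum_powerset_insert (by simp), ← sum_add_distrib, pow_succ, mul_inv, mul_assoc,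
    mul_sum]
  congr 1
  refine sum_congr rfl fun A hA => ?_
  beta_reduce
  rw [h1 A (mem_powerset.1 hA), h2 A]
  ring

lemma signAvg_succ_of_dependsOn {N : ℕ} {F : (ℕ → ℝ) → ℝ} (hF : DependsOn F (Set.Iio N)) :
    signAvg (N + 1) F = signAvg N F := by
  rw [signAvg_succ]
  congr 1
  ext x
  have h : ∀ a : ℝ, F (Function.update x N a) = F x := fun a =>
    hF fun j hj => Function.update_of_ne (ne_of_lt hj) _ _
  rw [h, h]; ring

/-- The two values of the fresh sign cancel; this is the martingale property. -/
lemma signAvg_succ_mul_of_dependsOn {N : ℕ} {F : (ℕ → ℝ) → ℝ} (hF : DependsOn F (Set.Iio N)) :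
    signAvg (N + 1) (fun x => x N * F x) = 0 := by
  rw [signAvg_succ]
  have h : ∀ (x : ℕ → ℝ) (a : ℝ), F (Function.update x N a) = F x := fun x a =>
    hF fun j hj => Function.update_of_ne (ne_of_lt hj) _ _
  simp only [h, Function.update_self]
  rw [← signAvg_const N 0]
  congr 1
  ext x
  ring

lemma dependsOn_prod (B : Finset ℕ) {N : ℕ} (hB : ∀ j ∈ B, j < N) :
    DependsOn (fun x : ℕ → ℝ => ∏ j ∈ B, x j) (Set.Iio N) :=
  fun _ _ h => prod_congr rfl fun j hj => h j (hB j hj)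

lemma signAvg_prod {N : ℕ} (B : Finset ℕ) (hB : B ⊆ range N) :
    signAvg N (fun x => ∏ j ∈ B, x j) = if B = ∅ then 1 else 0 := by
  induction N generalizing B with
  | zero =>
    have : B = ∅ := by simpa using hB
    subst this
    simp [signAvg_const]
  | succ N ih =>
    have hlt : ∀ j ∈ B, j ≠ N → j < N := fun j hj hne => by
      have := mem_range.1 (hB hj); omega
    by_cases hN : N ∈ B
    · rw [if_neg (ne_empty_of_mem hN)]
      have : (fun x : ℕ → ℝ => ∏ j ∈ B, x j) = fun x => x N * ∏ j ∈ B.erase N, x j := by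
        ext x; rw [mul_prod_erase _ _ hN]
      rw [this]
      exact signAvg_succ_mul_of_dependsOn (dependsOn_prod _ fun j hj =>
        hlt j (mem_of_mem_erase hj) (ne_of_mem_erase hj))
    · have h : ∀ j ∈ B, j < N := fun j hj => hlt j hj fun h => hN (h ▸ hj)
      rw [signAvg_succ_of_dependsOn (dependsOn_prod _ h)]
      exact ih _ fun j hj => mem_range.2 (h j hj)

lemma prod_signVec_mul_prod (A B C : Finset ℕ) :
    (∏ j ∈ B, signVec A j) * ∏ j ∈ C, signVec A j = ∏ j ∈ symmDiff B C, signVec A j := by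
  have h1 := prod_inter_mul_prod_sdiff B C (signVec A)
  have h2 := prod_inter_mul_prod_sdiff C B (signVec A)
  have h3 : (∏ j ∈ B ∩ C, signVec A j) * ∏ j ∈ B ∩ C, signVec A j = 1 := by
    rw [← prod_mul_distrib]; exact prod_eq_one fun j _ => signVec_mul_self A j
  rw [inter_comm] at h2
  rw [symmDiff_def, sup_eq_union, prod_union disjoint_sdiff_sdiff, ← h1, ← h2]
  linear_combination (∏ j ∈ B \ C, signVec A j) * (∏ j ∈ C \ B, signVec A j) * h3

lemma signAvg_prod_mul_prod {N : ℕ} {B C : Finset ℕ} (hB : B ⊆ range N) (hC : C ⊆ range N) :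
    signAvg N (fun x => (∏ j ∈ B, x j) * ∏ j ∈ C, x j) = if B = C then 1 else 0 := by
  have h : signAvg N (fun x => (∏ j ∈ B, x j) * ∏ j ∈ C, x j)
      = signAvg N (fun x => ∏ j ∈ symmDiff B C, x j) :=
    signAvg_congr fun A _ => prod_signVec_mul_prod A B C
  rw [h, signAvg_prod _ (symmDiff_subset_union.trans (union_subset hB hC))]
  simp only [← bot_eq_empty, symmDiff_eq_bot]

lemma signAvg_sum_mul_sum {ι κ : Type*} {N : ℕ} (I : Finset ι) (J : Finset κ)
    (c : ι → ℝ) (d : κ → ℝ) {φ : ι → Finset ℕ} {ψ : κ → Finset ℕ}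
    (hφ : ∀ s ∈ I, φ s ⊆ range N) (hψ : ∀ t ∈ J, ψ t ⊆ range N) :
    signAvg N (fun x => (∑ s ∈ I, c s * ∏ j ∈ φ s, x j) * ∑ t ∈ J, d t * ∏ j ∈ ψ t, x j)
      = ∑ s ∈ I, ∑ t ∈ J, if φ s = ψ t then c s * d t else 0 := by
  simp only [sum_mul_sum]
  rw [signAvg_sum]
  refine sum_congr rfl fun s hs => ?_
  rw [signAvg_sum]
  refine sum_congr rfl fun t ht => ?_
  have : (fun x : ℕ → ℝ => c s * (∏ j ∈ φ s, x j) * (d t * ∏ j ∈ ψ t, x j))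
      = fun x => (c s * d t) * ((∏ j ∈ φ s, x j) * ∏ j ∈ ψ t, x j) := by ext x; ring
  rw [this, signAvg_const_mul, signAvg_prod_mul_prod (hφ s hs) (hψ t ht), mul_ite, mul_one, mul_zero]

lemma signAvg_sum_mul_sum_eq_zero {ι κ : Type*} {N : ℕ} (I : Finset ι) (J : Finset κ)
    (c : ι → ℝ) (d : κ → ℝ) {φ : ι → Finset ℕ} {ψ : κ → Finset ℕ}
    (hφ : ∀ s ∈ I, φ s ⊆ range N) (hψ : ∀ t ∈ J, ψ t ⊆ range N)
    (hne : ∀ s ∈ I, ∀ t ∈ J, φ s ≠ ψ t) :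
    signAvg N (fun x => (∑ s ∈ I, c s * ∏ j ∈ φ s, x j) * ∑ t ∈ J, d t * ∏ j ∈ ψ t, x j) = 0 := by
  rw [signAvg_sum_mul_sum I J c d hφ hψ]
  exact sum_eq_zero fun s hs => sum_eq_zero fun t ht => if_neg (hne s hs t ht)

lemma signAvg_sum_mul_self_of_injOn {ι : Type*} {N : ℕ} (I : Finset ι) {φ : ι → Finset ℕ}
    (hφ : ∀ s ∈ I, φ s ⊆ range N) (hinj : Set.InjOn φ I) :
    signAvg N (fun x => (∑ s ∈ I, 1 * ∏ j ∈ φ s, x j) * ∑ s ∈ I, 1 * ∏ j ∈ φ s, x j) = #I := by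
  classical
  rw [signAvg_sum_mul_sum I I (fun _ => 1) (fun _ => 1) hφ hφ]
  have : ∀ s ∈ I, (∑ t ∈ I, if φ s = φ t then (1 : ℝ) * 1 else 0) = 1 := by
    intro s hs
    rw [sum_eq_single s]
    · simp
    · intro t ht hts
      exact if_neg fun h => hts (hinj ht hs h.symm)
    · exact fun h => absurd hs h
  rw [sum_congr rfl this]
  simp

/-! ### The energy as a martingale -/

/-- The sum of `x i * x |2v - i|` over `v < i < N`. -/
def pairSum (N v : ℕ) (x : ℕ → ℝ) : ℝ :=
  ∑ i ∈ Ioo v N, x i * x (2 * (v : ℤ) - i).natAbs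

/-- The centred sum over `0 < v < N` of the squares of the numbers `pairSum N v x + 1 / 2`. -/
def centredEnergy (N : ℕ) (x : ℕ → ℝ) : ℝ :=
  ∑ v ∈ Ioo 0 N, (pairSum N v x + pairSum N v x ^ 2 - ((N : ℝ) - 1 - v))

/-- The factor of `x M` in `centredEnergy (M + 1) x`. -/
def energyIncrement (M : ℕ) (x : ℕ → ℝ) : ℝ :=
  ∑ v ∈ Ioo 0 M, x (2 * (v : ℤ) - M).natAbs * (1 + 2 * pairSum M v x)

lemma dependsOn_pairSum {N v : ℕ} : DependsOn (pairSum N v) (Set.Iio N) := by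
  intro x y h
  refine sum_congr rfl fun i hi => ?_
  rw [mem_Ioo] at hi
  rw [h i hi.2, h _ (show (2 * (v : ℤ) - i).natAbs < N by omega)]

lemma dependsOn_centredEnergy {N : ℕ} : DependsOn (centredEnergy N) (Set.Iio N) := by
  intro x y h
  refine sum_congr rfl fun v _ => ?_
  rw [dependsOn_pairSum h]

lemma dependsOn_energyIncrement {N : ℕ} : DependsOn (energyIncrement N) (Set.Iio N) := by
  intro x y h
  refine sum_congr rfl fun v hv => ?_
  rw [mem_Ioo] at hv
  rw [dependsOn_pairSum h, h _ (show (2 * (v : ℤ) - N).natAbs < N by omega)]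

lemma pairSum_succ {N v : ℕ} (hv : v < N) (x : ℕ → ℝ) :
    pairSum (N + 1) v x = pairSum N v x + x N * x (2 * (v : ℤ) - N).natAbs := by
  have : Ioo v (N + 1) = insert N (Ioo v N) := by
    ext i; simp only [mem_Ioo, mem_insert]; omega
  rw [pairSum, this, sum_insert (by simp), add_comm]
  rfl

lemma pairSum_succ_self (N : ℕ) (x : ℕ → ℝ) : pairSum (N + 1) N x = 0 := by
  have : Ioo N (N + 1) = ∅ := by
    ext i; simp only [mem_Ioo, notMem_empty, iff_false]; omega
  rw [pairSum, this, sum_empty]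

/-- Each pair sum gains one product of signs. Its square is 1, which the growth of the centring
constant absorbs, so only terms linear in `x N` remain; the new summand v = N is zero. -/
lemma centredEnergy_succ {N : ℕ} (hN : 0 < N) {x : ℕ → ℝ} (hx : ∀ j, x j ^ 2 = 1) :
    centredEnergy (N + 1) x = centredEnergy N x + x N * energyIncrement N x := by
  have : Ioo 0 (N + 1) = insert N (Ioo 0 N) := by
    ext i; simp only [mem_Ioo, mem_insert]; omega
  rw [centredEnergy, this, sum_insert (by simp), pairSum_succ_self, centredEnergy, energyIncrement,
    mul_sum, ← sum_add_distrib]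
  push_cast
  rw [show (0 : ℝ) + 0 ^ 2 - ((N : ℝ) + 1 - 1 - N) = 0 by ring, zero_add]
  refine sum_congr rfl fun v hv => ?_
  rw [mem_Ioo] at hv
  rw [pairSum_succ hv.2]
  have h1 := hx N
  have h2 := hx (2 * (v : ℤ) - N).natAbs
  linear_combination (x (2 * (v : ℤ) - N).natAbs) ^ 2 * h1 + h2

lemma centredEnergy_one (x : ℕ → ℝ) : centredEnergy 1 x = 0 := by
  have : Ioo 0 1 = (∅ : Finset ℕ) := by decide
  rw [centredEnergy, this, sum_empty]

lemma signAvg_centredEnergy (N : ℕ) : signAvg (N + 1) (centredEnergy (N + 1)) = 0 := by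
  induction N with
  | zero =>
    rw [signAvg_congr (F' := fun _ => 0) fun A _ => centredEnergy_one _, signAvg_const]
  | succ N ih =>
    rw [signAvg_congr (F' := fun x => centredEnergy (N + 1) x + x (N + 1) * energyIncrement (N + 1) x)
        fun A _ => centredEnergy_succ N.succ_pos (signVec_sq A), signAvg_add,
      signAvg_succ_of_dependsOn dependsOn_centredEnergy, ih,
      signAvg_succ_mul_of_dependsOn dependsOn_energyIncrement, add_zero]

/-- Martingale increments are orthogonal: the cross term carries the fresh sign to the first power
and averages to zero. -/
lemma signAvg_centredEnergy_sq (N : ℕ) :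
    signAvg (N + 1) (fun x => centredEnergy (N + 1) x ^ 2) =
      ∑ M ∈ range N, signAvg (M + 1) (fun x => energyIncrement (M + 1) x ^ 2) := by
  induction N with
  | zero =>
    rw [signAvg_congr (F' := fun _ => 0) fun A _ => by rw [centredEnergy_one]; simp, signAvg_const]
    simp
  | succ N ih =>
    have h : signAvg (N + 1 + 1) (fun x => centredEnergy (N + 1 + 1) x ^ 2) =
        signAvg (N + 1 + 1) (fun x => (centredEnergy (N + 1) x ^ 2 + energyIncrement (N + 1) x ^ 2) +
          x (N + 1) * (2 * centredEnergy (N + 1) x * energyIncrement (N + 1) x)) := by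
      refine signAvg_congr fun A _ => ?_
      rw [centredEnergy_succ N.succ_pos (signVec_sq A)]
      linear_combination energyIncrement (N + 1) (signVec A) ^ 2 * signVec_sq A (N + 1)
    rw [h, signAvg_add, signAvg_succ_mul_of_dependsOn, add_zero,
      signAvg_succ_of_dependsOn, signAvg_add, ih, sum_range_succ]
    · intro x y h
      simp only [dependsOn_centredEnergy h, dependsOn_energyIncrement h]
    · intro x y h
      simp only [dependsOn_centredEnergy h, dependsOn_energyIncrement h]

/-! ### Expansion of an increment into sign products -/

/-- The pairs `0 < v < i < M` with `i` of the parity opposite to that of `M`. -/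
def mixedPairs (M : ℕ) : Finset (ℕ × ℕ) :=
  (Ioo 0 M ×ˢ Ioo 0 M).filter fun t => t.1 < t.2 ∧ t.2 % 2 ≠ M % 2

/-- The pairs `0 < v < i < M` with `i` of the parity of `M`. -/
def alignedPairs (M : ℕ) : Finset (ℕ × ℕ) :=
  (Ioo 0 M ×ˢ Ioo 0 M).filter fun t => t.1 < t.2 ∧ t.2 % 2 = M % 2

/-- The pairs `0 < q < r < M` with `|M - q - r| < q` and `q`, `r` of the parity of `M`. -/
def samePairs (M : ℕ) : Finset (ℕ × ℕ) :=
  (Ioo 0 M ×ˢ Ioo 0 M).filter fun t =>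
    t.1 < t.2 ∧ t.1 % 2 = M % 2 ∧ t.2 % 2 = M % 2 ∧ M < 2 * t.1 + t.2

/-- The coefficient of `x |M - 2v|` in the linear part of `energyIncrement M x`. -/
def linCoeff (M v : ℕ) : ℝ :=
  1 + (if v % 2 = M % 2 then 2 else 0) - (if 3 * v = M then 2 else 0)

/-- The numbers M - 2v, i, 2v - i add up to M and share its parity, so their roles can be exchanged.
A triple with distinct absolute values arises three times, once for each member serving as M - 2v; a
triple w, w, M - 2w leaves the sign at |M - 2w|. The case 3w = M would need i = v and is absent. -/
lemma sum_alignedPairs {x : ℕ → ℝ} (hx : ∀ j, x j * x j = 1) (M : ℕ) :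
    ∑ t ∈ alignedPairs M, x (2 * (t.1 : ℤ) - M).natAbs * (x t.2 * x (2 * (t.1 : ℤ) - t.2).natAbs) =
      (∑ v ∈ Ioo 0 M with v % 2 = M % 2 ∧ 3 * v ≠ M, x ((M : ℤ) - 2 * v).natAbs) +
      3 * ∑ t ∈ samePairs M, x ((M : ℤ) - t.1 - t.2).natAbs * (x t.1 * x t.2) := by
  have hx' : ∀ {a b c : ℕ}, a = b → x a * (x b * x c) = x c := by
    rintro a b c rfl; rw [← mul_assoc, hx, one_mul]
  -- Two possible coincidences of indices, then three cases by whether |2v - M| is the smallest,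
  -- middle or largest index.
  have hsplit : ∀ t ∈ alignedPairs M,
      x (2 * (t.1 : ℤ) - M).natAbs * (x t.2 * x (2 * (t.1 : ℤ) - t.2).natAbs) =
      (if 2 * t.1 + t.2 = M then x (2 * (t.1 : ℤ) - t.2).natAbs else 0) +
      (if 4 * t.1 = M + t.2 then x t.2 else 0) +
      (if (2 * (t.1 : ℤ) - M).natAbs < (2 * (t.1 : ℤ) - t.2).natAbs then
        x (2 * (t.1 : ℤ) - M).natAbs * (x t.2 * x (2 * (t.1 : ℤ) - t.2).natAbs) else 0) +
      (if (2 * (t.1 : ℤ) - t.2).natAbs < (2 * (t.1 : ℤ) - M).natAbs ∧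
          (2 * (t.1 : ℤ) - M).natAbs < t.2 then
        x (2 * (t.1 : ℤ) - M).natAbs * (x t.2 * x (2 * (t.1 : ℤ) - t.2).natAbs) else 0) +
      (if t.2 < (2 * (t.1 : ℤ) - M).natAbs then
        x (2 * (t.1 : ℤ) - M).natAbs * (x t.2 * x (2 * (t.1 : ℤ) - t.2).natAbs) else 0) := by
    rintro ⟨v, i⟩ ht
    simp only [alignedPairs, mem_filter, mem_product, mem_Ioo] at ht ⊢
    by_cases c1 : 2 * v + i = M
    · rw [if_pos c1, if_neg (by omega), if_neg (by omega), if_neg (by omega), if_neg (by omega),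
        hx' (by omega)]
      ring
    by_cases c2 : 4 * v = M + i
    · rw [if_neg c1, if_pos c2, if_neg (by omega), if_neg (by omega), if_neg (by omega),
        mul_comm (x i), hx' (by omega)]
      ring
    by_cases c3 : (2 * (v : ℤ) - M).natAbs < (2 * (v : ℤ) - i).natAbs
    · rw [if_neg c1, if_neg c2, if_pos c3, if_neg (by omega), if_neg (by omega)]
      ring
    by_cases c4 : i < (2 * (v : ℤ) - M).natAbs
    · rw [if_neg c1, if_neg c2, if_neg c3, if_neg (by omega), if_pos c4]
      ring
    · rw [if_neg c1, if_neg c2, if_neg c3, if_pos (by omega), if_neg c4]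
      ring
  rw [sum_congr rfl hsplit]
  simp only [sum_add_distrib, ← sum_filter]
  -- The repeated index is w = i, and v < i becomes M < 3w.
  have h1 : ∑ t ∈ alignedPairs M with 2 * t.1 + t.2 = M, x (2 * (t.1 : ℤ) - t.2).natAbs =
      ∑ v ∈ Ioo 0 M with v % 2 = M % 2 ∧ M < 3 * v, x ((M : ℤ) - 2 * v).natAbs := by
    refine sum_nbij' (fun t => t.2) (fun v => ((M - v) / 2, v)) ?_ ?_ ?_ ?_ ?_
    all_goals
      simp only [alignedPairs, mem_filter, mem_product, mem_Ioo, Prod.forall, Prod.mk.injEq, and_true]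
      intros
    · omega
    · omega
    · omega
    · trivial
    · congr 1; omega
  -- The repeated index is w = 2v - i, and v < i becomes 3w < M.
  have h2 : ∑ t ∈ alignedPairs M with 4 * t.1 = M + t.2, x t.2 =
      ∑ v ∈ Ioo 0 M with v % 2 = M % 2 ∧ 3 * v < M, x ((M : ℤ) - 2 * v).natAbs := by
    refine sum_nbij' (fun t => 2 * t.1 - t.2) (fun v => ((M - v) / 2, M - 2 * v)) ?_ ?_ ?_ ?_ ?_
    all_goals
      simp only [alignedPairs, mem_filter, mem_product, mem_Ioo, Prod.forall, Prod.mk.injEq]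
      intros
    · omega
    · omega
    · omega
    · omega
    · congr 1; omega
  have h3 : ∑ t ∈ alignedPairs M with
        (2 * (t.1 : ℤ) - M).natAbs < (2 * (t.1 : ℤ) - t.2).natAbs,
        x (2 * (t.1 : ℤ) - M).natAbs * (x t.2 * x (2 * (t.1 : ℤ) - t.2).natAbs) =
      ∑ t ∈ samePairs M, x ((M : ℤ) - t.1 - t.2).natAbs * (x t.1 * x t.2) := by
    refine sum_nbij' (fun t => (2 * t.1 - t.2, t.2)) (fun t => ((t.1 + t.2) / 2, t.2)) ?_ ?_ ?_ ?_ ?_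
    all_goals
      simp only [alignedPairs, samePairs, mem_filter, mem_product, mem_Ioo, Prod.forall, Prod.mk.injEq, and_true]
      intro v i h
    · omega
    · omega
    · omega
    · omega
    · rw [mul_comm (x i)]; congr 2
      · omega
      · congr 1; omega
  have h4 : ∑ t ∈ alignedPairs M with
        (2 * (t.1 : ℤ) - t.2).natAbs < (2 * (t.1 : ℤ) - M).natAbs ∧
          (2 * (t.1 : ℤ) - M).natAbs < t.2,
        x (2 * (t.1 : ℤ) - M).natAbs * (x t.2 * x (2 * (t.1 : ℤ) - t.2).natAbs) =
      ∑ t ∈ samePairs M, x ((M : ℤ) - t.1 - t.2).natAbs * (x t.1 * x t.2) := by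
    refine sum_nbij' (fun t => (M - 2 * t.1, t.2)) (fun t => ((M - t.1) / 2, t.2)) ?_ ?_ ?_ ?_ ?_
    all_goals
      simp only [alignedPairs, samePairs, mem_filter, mem_product, mem_Ioo, Prod.forall, Prod.mk.injEq, and_true]
      intro v i h
    · omega
    · omega
    · omega
    · omega
    · have e1 : (2 * (v : ℤ) - M).natAbs = M - 2 * v := by omega
      have e2 : (2 * (v : ℤ) - i).natAbs = ((M : ℤ) - (M - 2 * v : ℕ) - i).natAbs := by omega
      rw [e1, e2]; ring
  have h5 : ∑ t ∈ alignedPairs M with t.2 < (2 * (t.1 : ℤ) - M).natAbs,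
        x (2 * (t.1 : ℤ) - M).natAbs * (x t.2 * x (2 * (t.1 : ℤ) - t.2).natAbs) =
      ∑ t ∈ samePairs M, x ((M : ℤ) - t.1 - t.2).natAbs * (x t.1 * x t.2) := by
    refine sum_nbij' (fun t => (t.2, M - 2 * t.1)) (fun t => ((M - t.2) / 2, t.1)) ?_ ?_ ?_ ?_ ?_
    all_goals
      simp only [alignedPairs, samePairs, mem_filter, mem_product, mem_Ioo, Prod.forall, Prod.mk.injEq, and_true, true_and]
      intro v i h
    · omega
    · omega
    · omega
    · omega
    · have e1 : (2 * (v : ℤ) - M).natAbs = M - 2 * v := by omega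
      have e2 : (2 * (v : ℤ) - i).natAbs = ((M : ℤ) - i - (M - 2 * v : ℕ)).natAbs := by omega
      rw [e1, e2]; ring
  have h6 : ∑ v ∈ Ioo 0 M with v % 2 = M % 2 ∧ 3 * v ≠ M, x ((M : ℤ) - 2 * v).natAbs =
      (∑ v ∈ Ioo 0 M with v % 2 = M % 2 ∧ M < 3 * v, x ((M : ℤ) - 2 * v).natAbs) +
      ∑ v ∈ Ioo 0 M with v % 2 = M % 2 ∧ 3 * v < M, x ((M : ℤ) - 2 * v).natAbs := by
    rw [← sum_union]
    · congr 1
      ext v; simp only [mem_filter, mem_union, mem_Ioo]; omega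
    · rw [disjoint_left]; intro v; simp only [mem_filter]; omega
  rw [h1, h2, h3, h4, h5, h6]
  ring

lemma energyIncrement_eq {x : ℕ → ℝ} (hx : ∀ j, x j * x j = 1) (M : ℕ) :
    energyIncrement M x =
      (∑ v ∈ Ioo 0 M, linCoeff M v * x ((M : ℤ) - 2 * v).natAbs) +
      2 * (∑ t ∈ mixedPairs M,
        x (2 * (t.1 : ℤ) - M).natAbs * (x t.2 * x (2 * (t.1 : ℤ) - t.2).natAbs)) +
      6 * ∑ t ∈ samePairs M, x ((M : ℤ) - t.1 - t.2).natAbs * (x t.1 * x t.2) := by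
  have h1 : ∑ v ∈ Ioo 0 M, x (2 * (v : ℤ) - M).natAbs * pairSum M v x =
      (∑ t ∈ mixedPairs M,
        x (2 * (t.1 : ℤ) - M).natAbs * (x t.2 * x (2 * (t.1 : ℤ) - t.2).natAbs)) +
      ∑ t ∈ alignedPairs M,
        x (2 * (t.1 : ℤ) - M).natAbs * (x t.2 * x (2 * (t.1 : ℤ) - t.2).natAbs) := by
    rw [← sum_union]
    · have : mixedPairs M ∪ alignedPairs M = (Ioo 0 M ×ˢ Ioo 0 M).filter fun t => t.1 < t.2 := by
        ext t; simp only [mixedPairs, alignedPairs, mem_filter, mem_union]; tauto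
      rw [this, sum_filter, sum_product]
      refine sum_congr rfl fun v hv => ?_
      rw [pairSum, mul_sum, ← sum_filter]
      refine sum_congr ?_ fun _ _ => rfl
      ext i; simp only [mem_Ioo, mem_filter] at hv ⊢; omega
    · rw [disjoint_left]; intro t; simp only [mixedPairs, alignedPairs, mem_filter]; tauto
  have h2 : ∑ v ∈ Ioo 0 M, linCoeff M v * x ((M : ℤ) - 2 * v).natAbs =
      (∑ v ∈ Ioo 0 M, x (2 * (v : ℤ) - M).natAbs) +
      2 * ∑ v ∈ Ioo 0 M with v % 2 = M % 2 ∧ 3 * v ≠ M, x ((M : ℤ) - 2 * v).natAbs := by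
    rw [sum_filter, mul_sum, ← sum_add_distrib]
    refine sum_congr rfl fun v _ => ?_
    rw [show (2 * (v : ℤ) - M).natAbs = ((M : ℤ) - 2 * v).natAbs by omega, linCoeff]
    by_cases c1 : 3 * v = M
    · rw [if_pos c1, if_pos (by omega), if_neg (by tauto)]; ring
    by_cases c2 : v % 2 = M % 2
    · rw [if_neg c1, if_pos c2, if_pos ⟨c2, c1⟩]; ring
    · rw [if_neg c1, if_neg c2, if_neg (by tauto)]; ring
  rw [h2, energyIncrement]
  have h3 : ∑ v ∈ Ioo 0 M, x (2 * (v : ℤ) - M).natAbs * (1 + 2 * pairSum M v x) =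
      (∑ v ∈ Ioo 0 M, x (2 * (v : ℤ) - M).natAbs) +
      2 * ∑ v ∈ Ioo 0 M, x (2 * (v : ℤ) - M).natAbs * pairSum M v x := by
    rw [mul_sum, ← sum_add_distrib]
    exact sum_congr rfl fun v _ => by ring
  rw [h3, h1, sum_alignedPairs hx]
  ring

/-! ### Second moment of an increment -/

lemma prod_triple {x : ℕ → ℝ} {a b c : ℕ} (hab : a ≠ b) (hac : a ≠ c) (hbc : b ≠ c) :
    ∏ j ∈ {a, b, c}, x j = x a * (x b * x c) := by
  rw [prod_insert (by simp [hab, hac]), prod_insert (by simp [hbc]), prod_singleton]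

lemma eq_of_triple_eq {a b c a' b' c' : ℕ} (hab : a < b) (hbc : b < c) (hab' : a' < b')
    (hbc' : b' < c') (h : ({a, b, c} : Finset ℕ) = {a', b', c'}) : a = a' ∧ b = b' ∧ c = c' := by
  have h1 : ∀ j, (j = a ∨ j = b ∨ j = c) ↔ (j = a' ∨ j = b' ∨ j = c') := by
    intro j; simpa using congrArg (j ∈ ·) h
  have ha := h1 a
  have hb := h1 b
  have hc := h1 c
  have ha' := h1 a'
  have hb' := h1 b'
  have hc' := h1 c'
  omega

lemma signAvg_sq_add_add (N : ℕ) (F₁ F₂ F₃ : (ℕ → ℝ) → ℝ)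
    (h₁₂ : signAvg N (fun x => F₁ x * F₂ x) = 0) (h₁₃ : signAvg N (fun x => F₁ x * F₃ x) = 0)
    (h₂₃ : signAvg N (fun x => F₂ x * F₃ x) = 0) (a b : ℝ) :
    signAvg N (fun x => (F₁ x + a * F₂ x + b * F₃ x) ^ 2) =
      signAvg N (fun x => F₁ x * F₁ x) + a ^ 2 * signAvg N (fun x => F₂ x * F₂ x) +
      b ^ 2 * signAvg N (fun x => F₃ x * F₃ x) := by
  have h : (fun x : ℕ → ℝ => (F₁ x + a * F₂ x + b * F₃ x) ^ 2) = fun x =>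
      ((((F₁ x * F₁ x + a ^ 2 * (F₂ x * F₂ x)) + b ^ 2 * (F₃ x * F₃ x)) +
        (2 * a) * (F₁ x * F₂ x)) + (2 * b) * (F₁ x * F₃ x)) + (2 * a * b) * (F₂ x * F₃ x) := by
    ext x; ring
  rw [h]
  simp only [signAvg_add, signAvg_const_mul, h₁₂, h₁₃, h₂₃]
  ring

lemma signAvg_energyIncrement_sq (M : ℕ) :
    signAvg M (fun x => energyIncrement M x ^ 2) =
      (∑ v ∈ Ioo 0 M, ∑ w ∈ Ioo 0 M,
        if ((M : ℤ) - 2 * v).natAbs = ((M : ℤ) - 2 * w).natAbs then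
          linCoeff M v * linCoeff M w else 0) +
      4 * #(mixedPairs M) + 36 * #(samePairs M) := by
  let φ₁ : ℕ → Finset ℕ := fun v => {((M : ℤ) - 2 * v).natAbs}
  let φ₂ : ℕ × ℕ → Finset ℕ := fun t =>
    {(2 * (t.1 : ℤ) - M).natAbs, t.2, (2 * (t.1 : ℤ) - t.2).natAbs}
  let φ₃ : ℕ × ℕ → Finset ℕ := fun t => {((M : ℤ) - t.1 - t.2).natAbs, t.1, t.2}
  have r₁ : ∀ v ∈ Ioo 0 M, φ₁ v ⊆ range M := by
    intro v hv
    simp only [φ₁, singleton_subset_iff, mem_range, mem_Ioo] at hv ⊢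
    omega
  have r₂ : ∀ t ∈ mixedPairs M, φ₂ t ⊆ range M := by
    intro t ht
    simp only [φ₂, mixedPairs, insert_subset_iff, singleton_subset_iff, mem_range, mem_filter,
      mem_product, mem_Ioo] at ht ⊢
    omega
  have r₃ : ∀ t ∈ samePairs M, φ₃ t ⊆ range M := by
    intro t ht
    simp only [φ₃, samePairs, insert_subset_iff, singleton_subset_iff, mem_range, mem_filter,
      mem_product, mem_Ioo] at ht ⊢
    omega
  have p₂ : ∀ (x : ℕ → ℝ), ∀ t ∈ mixedPairs M, ∏ j ∈ φ₂ t, x j =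
      x (2 * (t.1 : ℤ) - M).natAbs * (x t.2 * x (2 * (t.1 : ℤ) - t.2).natAbs) := by
    intro x t ht
    simp only [mixedPairs, mem_filter, mem_product, mem_Ioo] at ht
    exact prod_triple (by omega) (by omega) (by omega)
  have p₃ : ∀ (x : ℕ → ℝ), ∀ t ∈ samePairs M, ∏ j ∈ φ₃ t, x j =
      x ((M : ℤ) - t.1 - t.2).natAbs * (x t.1 * x t.2) := by
    intro x t ht
    simp only [samePairs, mem_filter, mem_product, mem_Ioo] at ht
    exact prod_triple (by omega) (by omega) (by omega)
  -- Parity separates |2v - M| from the other two indices, of which i is the larger. Then |2v - M|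
  -- fixes v up to v ↦ M - v and |2v - i| up to v ↦ i - v; since i < M, v is determined.
  have i₂ : Set.InjOn φ₂ (mixedPairs M) := by
    rintro ⟨v, i⟩ ht ⟨w, j⟩ hs h
    simp only [mixedPairs, coe_filter, Set.mem_ofPred_eq, mem_product, mem_Ioo] at ht hs
    have h1 : ∀ k, (k = (2 * (v : ℤ) - M).natAbs ∨ k = i ∨ k = (2 * (v : ℤ) - i).natAbs) ↔
        (k = (2 * (w : ℤ) - M).natAbs ∨ k = j ∨ k = (2 * (w : ℤ) - j).natAbs) := by
      intro k; simpa [φ₂] using congrArg (k ∈ ·) h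
    have e1 := (h1 (2 * (v : ℤ) - M).natAbs).1 (by simp)
    have e2 := (h1 i).1 (by simp)
    have e3 := (h1 j).2 (by simp)
    have e4 := (h1 (2 * (v : ℤ) - i).natAbs).1 (by simp)
    have f2 : i = j := by omega
    subst f2
    have f1 : (2 * (v : ℤ) - M).natAbs = (2 * (w : ℤ) - M).natAbs := by omega
    have f4 : (2 * (v : ℤ) - i).natAbs = (2 * (w : ℤ) - i).natAbs := by omega
    rw [Prod.mk.injEq]
    omega
  have i₃ : Set.InjOn φ₃ (samePairs M) := by
    rintro ⟨q, r⟩ ht ⟨q', r'⟩ hs h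
    simp only [samePairs, coe_filter, Set.mem_ofPred_eq, mem_product, mem_Ioo] at ht hs
    have := eq_of_triple_eq (by omega) (by omega) (by omega) (by omega) h
    rw [Prod.mk.injEq]
    exact this.2
  have n₁₂ : ∀ v ∈ Ioo 0 M, ∀ t ∈ mixedPairs M, φ₁ v ≠ φ₂ t := by
    intro v hv t ht h
    simp only [mixedPairs, mem_filter, mem_product, mem_Ioo] at ht hv
    have h1 : t.2 ∈ φ₁ v := by rw [h]; simp [φ₂]
    have h2 : (2 * (t.1 : ℤ) - M).natAbs ∈ φ₁ v := by rw [h]; simp [φ₂]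
    simp only [φ₁, mem_singleton] at h1 h2
    omega
  have n₁₃ : ∀ v ∈ Ioo 0 M, ∀ t ∈ samePairs M, φ₁ v ≠ φ₃ t := by
    intro v hv t ht h
    simp only [samePairs, mem_filter, mem_product, mem_Ioo] at ht hv
    have h1 : t.1 ∈ φ₁ v := by rw [h]; simp [φ₃]
    have h2 : t.2 ∈ φ₁ v := by rw [h]; simp [φ₃]
    simp only [φ₁, mem_singleton] at h1 h2
    omega
  -- A mixed triple contains an index of the wrong parity.
  have n₂₃ : ∀ s ∈ mixedPairs M, ∀ t ∈ samePairs M, φ₂ s ≠ φ₃ t := by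
    intro s hs t ht h
    simp only [samePairs, mixedPairs, mem_filter, mem_product, mem_Ioo] at ht hs
    have h1 : s.2 ∈ φ₃ t := by rw [← h]; simp [φ₂]
    simp only [φ₃, mem_insert, mem_singleton] at h1
    omega
  rw [signAvg_congr (F' := fun x => ((∑ v ∈ Ioo 0 M, linCoeff M v * ∏ j ∈ φ₁ v, x j) +
      2 * (∑ t ∈ mixedPairs M, 1 * ∏ j ∈ φ₂ t, x j) +
      6 * ∑ t ∈ samePairs M, 1 * ∏ j ∈ φ₃ t, x j) ^ 2),
    signAvg_sq_add_add M _ _ _ (signAvg_sum_mul_sum_eq_zero _ _ _ _ r₁ r₂ n₁₂)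
      (signAvg_sum_mul_sum_eq_zero _ _ _ _ r₁ r₃ n₁₃)
      (signAvg_sum_mul_sum_eq_zero _ _ _ _ r₂ r₃ n₂₃),
    signAvg_sum_mul_self_of_injOn _ r₂ i₂, signAvg_sum_mul_self_of_injOn _ r₃ i₃,
    signAvg_sum_mul_sum _ _ _ _ r₁ r₁]
  · simp only [φ₁, singleton_inj]
    norm_num
  · intro A _
    rw [energyIncrement_eq (signVec_mul_self A)]
    simp only [one_mul]
    rw [sum_congr rfl (p₂ (signVec A)), sum_congr rfl (p₃ (signVec A))]
    simp only [φ₁, prod_singleton]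

/-! ### Linear coefficients and lattice point counts -/

/-- The index |M - 2v| is shared by v and M - v only; when 2v = M these agree and must be counted
once. -/
lemma sum_linCoeff_mul (M : ℕ) :
    (∑ v ∈ Ioo 0 M, ∑ w ∈ Ioo 0 M,
        if ((M : ℤ) - 2 * v).natAbs = ((M : ℤ) - 2 * w).natAbs then
          linCoeff M v * linCoeff M w else 0) =
      ∑ v ∈ Ioo 0 M, (linCoeff M v * linCoeff M v +
        if 2 * v = M then 0 else linCoeff M v * linCoeff M (M - v)) := by
  refine sum_congr rfl fun v hv => ?_
  rw [mem_Ioo] at hv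
  have h : ∀ w ∈ Ioo 0 M,
      (if ((M : ℤ) - 2 * v).natAbs = ((M : ℤ) - 2 * w).natAbs then
          linCoeff M v * linCoeff M w else 0) =
      (if w = v then linCoeff M v * linCoeff M w else 0) +
      if w = M - v then (if 2 * v = M then 0 else linCoeff M v * linCoeff M w) else 0 := by
    intro w hw
    rw [mem_Ioo] at hw
    by_cases c1 : w = v
    · rw [if_pos (by omega), if_pos c1]
      split_ifs
      · simp
      · omega
      · simp
    by_cases c2 : w = M - v
    · rw [if_pos (by omega), if_neg c1, if_pos c2, if_neg (by omega)]; simp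
    · rw [if_neg (by omega), if_neg c1, if_neg c2]; simp
  rw [sum_congr rfl h, sum_add_distrib, sum_ite_eq', sum_ite_eq', if_pos (by rw [mem_Ioo]; omega),
    if_pos (by rw [mem_Ioo]; omega)]

lemma sum_Ioo_zero_ite_three_mul (M : ℕ) (hM : 0 < M) (c : ℝ) :
    (∑ v ∈ Ioo 0 M, if 3 * v = M then c else 0) = if 3 ∣ M then c else 0 := by
  split_ifs with h
  · obtain ⟨k, rfl⟩ := h
    simp only [Nat.mul_right_inj (by norm_num : 3 ≠ 0)]
    rw [sum_ite_eq', if_pos (by rw [mem_Ioo]; omega)]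
  · exact sum_eq_zero fun v _ => if_neg (by omega)

lemma sum_Ioo_zero_ite_three_mul_eq_two_mul (M : ℕ) (hM : 0 < M) (c : ℝ) :
    (∑ v ∈ Ioo 0 M, if 3 * v = 2 * M then c else 0) = if 3 ∣ M then c else 0 := by
  split_ifs with h
  · obtain ⟨k, rfl⟩ := h
    rw [sum_congr rfl fun v _ => (if_congr (by omega : 3 * v = 2 * (3 * k) ↔ v = 2 * k) rfl rfl),
      sum_ite_eq', if_pos (by rw [mem_Ioo]; omega)]
  · exact sum_eq_zero fun v _ => if_neg (by omega)

lemma sum_Ioo_zero_ite_odd (K : ℕ) (c : ℝ) :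
    (∑ v ∈ Ioo 0 (2 * K + 1), if v % 2 = 1 then c else 0) = K * c := by
  induction K with
  | zero =>
    have : Ioo 0 (2 * 0 + 1) = (∅ : Finset ℕ) := by decide
    rw [this]; simp
  | succ K ih =>
    have : Ioo 0 (2 * (K + 1) + 1) = insert (2 * K + 2) (insert (2 * K + 1) (Ioo 0 (2 * K + 1))) := by
      ext v; simp only [mem_Ioo, mem_insert]; omega
    rw [this, sum_insert (by simp), sum_insert (by simp), ih, if_neg (by omega), if_pos (by omega)]
    push_cast; ring

lemma sum_Ioo_zero_ite_even (K : ℕ) (c : ℝ) :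
    (∑ v ∈ Ioo 0 (2 * (K + 1)), if v % 2 = 0 then c else 0) = K * c := by
  induction K with
  | zero =>
    have : Ioo 0 (2 * (0 + 1)) = {1} := by decide
    rw [this]; simp
  | succ K ih =>
    have : Ioo 0 (2 * (K + 1 + 1)) =
        insert (2 * K + 3) (insert (2 * K + 2) (Ioo 0 (2 * (K + 1)))) := by
      ext v; simp only [mem_Ioo, mem_insert]; omega
    rw [this, sum_insert (by simp only [mem_insert, mem_Ioo]; omega),
      sum_insert (by simp only [mem_Ioo]; omega), ih, if_neg (by omega), if_pos (by omega)]
    push_cast; ring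

lemma sum_linCoeff_mul_odd (K : ℕ) :
    ∑ v ∈ Ioo 0 (2 * K + 1), (linCoeff (2 * K + 1) v * linCoeff (2 * K + 1) v +
        if 2 * v = 2 * K + 1 then 0 else
          linCoeff (2 * K + 1) v * linCoeff (2 * K + 1) (2 * K + 1 - v)) =
      16 * K - if 3 ∣ 2 * K + 1 then 12 else 0 := by
  -- The coefficient is 3 at odd v and 1 at even v, and v, M - v have opposite parity: 9 + 3 or 1 +
  -- 3. The exceptional coefficient 1 at M/3 lowers the terms v = M/3 and v = 2M/3.
  have h : ∀ v ∈ Ioo 0 (2 * K + 1), (linCoeff (2 * K + 1) v * linCoeff (2 * K + 1) v +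
        if 2 * v = 2 * K + 1 then 0 else
          linCoeff (2 * K + 1) v * linCoeff (2 * K + 1) (2 * K + 1 - v)) =
      4 + (if v % 2 = 1 then 8 else 0) - (if 3 * v = 2 * K + 1 then 10 else 0) -
        (if 3 * v = 2 * (2 * K + 1) then 2 else 0) := by
    intro v hv
    rw [mem_Ioo] at hv
    rw [if_neg (by omega), linCoeff, linCoeff]
    by_cases c : v % 2 = 1
    · rw [if_pos (by omega), if_neg (show ¬ (2 * K + 1 - v) % 2 = (2 * K + 1) % 2 by omega),
        if_neg (show ¬ 3 * (2 * K + 1 - v) = 2 * K + 1 by omega), if_pos c,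
        if_neg (show ¬ 3 * v = 2 * (2 * K + 1) by omega)]
      split_ifs <;> norm_num
    · rw [if_neg (show ¬ v % 2 = (2 * K + 1) % 2 by omega),
        if_neg (show ¬ 3 * v = 2 * K + 1 by omega),
        if_neg (show ¬ 3 * v = 2 * K + 1 by omega),
        if_pos (show (2 * K + 1 - v) % 2 = (2 * K + 1) % 2 by omega), if_neg c]
      by_cases c2 : 3 * v = 2 * (2 * K + 1)
      · rw [if_pos (show 3 * (2 * K + 1 - v) = 2 * K + 1 by omega), if_pos c2]; norm_num
      · rw [if_neg (show ¬ 3 * (2 * K + 1 - v) = 2 * K + 1 by omega), if_neg c2]; norm_num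
  rw [sum_congr rfl h, sum_sub_distrib, sum_sub_distrib, sum_add_distrib, sum_Ioo_zero_ite_odd,
    sum_Ioo_zero_ite_three_mul _ (by omega), sum_Ioo_zero_ite_three_mul_eq_two_mul _ (by omega)]
  simp only [sum_const, Nat.card_Ioo, nsmul_eq_mul]
  rw [show 2 * K + 1 - 0 - 1 = 2 * K by omega]
  push_cast
  split_ifs <;> ring

lemma sum_linCoeff_mul_even (K : ℕ) :
    ∑ v ∈ Ioo 0 (2 * (K + 1)), (linCoeff (2 * (K + 1)) v * linCoeff (2 * (K + 1)) v +
        if 2 * v = 2 * (K + 1) then 0 else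
          linCoeff (2 * (K + 1)) v * linCoeff (2 * (K + 1)) (2 * (K + 1) - v)) =
      20 * K + 1 - (if 2 ∣ K + 1 then 8 else 0) - if 3 ∣ K + 1 then 20 else 0 := by
  -- Now v and M - v have the same parity: 9 + 9 or 1 + 1. The corrections come from v = M/3, v =
  -- 2M/3 and the midpoint, which has no partner.
  have h : ∀ v ∈ Ioo 0 (2 * (K + 1)), (linCoeff (2 * (K + 1)) v * linCoeff (2 * (K + 1)) v +
        if 2 * v = 2 * (K + 1) then 0 else
          linCoeff (2 * (K + 1)) v * linCoeff (2 * (K + 1)) (2 * (K + 1) - v)) =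
      2 + (if v % 2 = 0 then 16 else 0) - (if 3 * v = 2 * (K + 1) then 14 else 0) -
        (if 3 * v = 2 * (2 * (K + 1)) then 6 else 0) -
        (if v = K + 1 then (if 2 ∣ K + 1 then 9 else 1) else 0) := by
    intro v hv
    rw [mem_Ioo] at hv
    by_cases c1 : v = K + 1
    · subst c1
      rw [if_pos rfl, if_pos rfl, linCoeff, if_neg (show ¬ 3 * (K + 1) = 2 * (K + 1) by omega),
        if_neg (show ¬ 3 * (K + 1) = 2 * (2 * (K + 1)) by omega)]
      by_cases c : 2 ∣ K + 1
      · rw [if_pos (by omega), if_pos (by omega), if_pos c]; norm_num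
      · rw [if_neg (by omega), if_neg (by omega), if_neg c]; norm_num
    rw [if_neg (by omega), if_neg c1, linCoeff, linCoeff]
    by_cases c : v % 2 = 0
    · rw [if_pos (by omega), if_pos (show (2 * (K + 1) - v) % 2 = (2 * (K + 1)) % 2 by omega),
        if_pos c]
      by_cases c2 : 3 * v = 2 * (2 * (K + 1))
      · rw [if_neg (show ¬ 3 * v = 2 * (K + 1) by omega),
          if_neg (show ¬ 3 * v = 2 * (K + 1) by omega),
          if_pos (show 3 * (2 * (K + 1) - v) = 2 * (K + 1) by omega), if_pos c2]
        norm_num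
      · rw [if_neg (show ¬ 3 * (2 * (K + 1) - v) = 2 * (K + 1) by omega), if_neg c2]
        split_ifs <;> norm_num
    · rw [if_neg (show ¬ v % 2 = (2 * (K + 1)) % 2 by omega),
        if_neg (show ¬ 3 * v = 2 * (K + 1) by omega),
        if_neg (show ¬ 3 * v = 2 * (K + 1) by omega),
        if_neg (show ¬ (2 * (K + 1) - v) % 2 = (2 * (K + 1)) % 2 by omega),
        if_neg (show ¬ 3 * (2 * (K + 1) - v) = 2 * (K + 1) by omega), if_neg c,
        if_neg (show ¬ 3 * v = 2 * (2 * (K + 1)) by omega)]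
      norm_num
  rw [sum_congr rfl h, sum_sub_distrib, sum_sub_distrib, sum_sub_distrib, sum_add_distrib,
    sum_Ioo_zero_ite_even, sum_Ioo_zero_ite_three_mul _ (by omega),
    sum_Ioo_zero_ite_three_mul_eq_two_mul _ (by omega), sum_ite_eq',
    if_pos (show K + 1 ∈ Ioo 0 (2 * (K + 1)) by rw [mem_Ioo]; omega)]
  simp only [sum_const, Nat.card_Ioo, nsmul_eq_mul]
  rw [show 2 * (K + 1) - 0 - 1 = 2 * K + 1 by omega]
  by_cases c : 3 ∣ K + 1
  · have c' : 3 ∣ 2 * (K + 1) := by omega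
    rw [if_pos c', if_pos c', if_pos c]
    push_cast
    split_ifs <;> ring
  · have c' : ¬ 3 ∣ 2 * (K + 1) := by omega
    rw [if_neg c', if_neg c', if_neg c]
    push_cast
    split_ifs <;> ring

lemma card_mixedPairs (M : ℕ) :
    #(mixedPairs M) = ∑ i ∈ range M, if i % 2 ≠ M % 2 then i - 1 else 0 := by
  have h : #(mixedPairs M) =
      #((range M).sigma fun i => range (if i % 2 ≠ M % 2 then i - 1 else 0)) := by
    refine card_nbij' (fun t => ⟨t.2, t.1 - 1⟩) (fun t => (t.2 + 1, t.1)) ?_ ?_ ?_ ?_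
    · rintro ⟨v, i⟩ ht
      simp only [mixedPairs, mem_coe, mem_filter, mem_product, mem_Ioo, mem_sigma,
        mem_range] at ht ⊢
      rw [if_pos ht.2.2]; omega
    · rintro ⟨i, s⟩ ht
      simp only [mixedPairs, mem_coe, mem_filter, mem_product, mem_Ioo, mem_sigma,
        mem_range] at ht ⊢
      split_ifs at ht <;> omega
    · rintro ⟨v, i⟩ ht
      simp only [mixedPairs, mem_coe, mem_filter, mem_product, mem_Ioo] at ht
      simp only [Prod.mk.injEq, and_true]; omega
    · rintro ⟨i, s⟩ ht
      simp
  rw [h, card_sigma]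
  simp only [card_range]

lemma card_mixedPairs_odd (K : ℕ) : #(mixedPairs (2 * K + 1)) = K * K := by
  rw [card_mixedPairs]
  induction K with
  | zero => simp
  | succ K ih =>
    rw [show 2 * (K + 1) + 1 = 2 * K + 1 + 1 + 1 by ring, sum_range_succ, sum_range_succ,
      if_neg (by omega), if_pos (by omega),
      sum_congr rfl fun i _ => (if_congr (by omega : i % 2 ≠ (2 * K + 1 + 1 + 1) % 2 ↔
        i % 2 ≠ (2 * K + 1) % 2) rfl rfl), ih]
    rw [show 2 * K + 1 + 1 - 1 = 2 * K + 1 by omega]; ring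

lemma card_mixedPairs_even (K : ℕ) : #(mixedPairs (2 * (K + 1))) = (K + 1) * K := by
  rw [card_mixedPairs]
  induction K with
  | zero => decide
  | succ K ih =>
    rw [show 2 * (K + 1 + 1) = 2 * (K + 1) + 1 + 1 by ring, sum_range_succ, sum_range_succ,
      if_neg (by omega), if_pos (by omega),
      sum_congr rfl fun i _ => (if_congr (by omega : i % 2 ≠ (2 * (K + 1) + 1 + 1) % 2 ↔
        i % 2 ≠ (2 * (K + 1)) % 2) rfl rfl), ih]
    rw [Nat.add_sub_cancel]; ring

/-- With q = 2a and r = 2(K - (s + 1)) the conditions become (s + 1)/2 < a < K - (s + 1); truncated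
subtraction counts an empty range as 0. -/
lemma card_samePairs_even (K : ℕ) :
    #(samePairs (2 * K)) = ∑ s ∈ range K, (K - 1 - (s + 1) - (s + 1) / 2) := by
  have h : #(samePairs (2 * K)) =
      #((range K).sigma fun s => range (K - 1 - (s + 1) - (s + 1) / 2)) := by
    refine card_nbij' (fun t => ⟨K - t.2 / 2 - 1, t.1 / 2 - (K - t.2 / 2) / 2 - 1⟩)
      (fun t => (2 * ((t.1 + 1) / 2 + 1 + t.2), 2 * (K - (t.1 + 1)))) ?_ ?_ ?_ ?_
    · rintro ⟨q, r⟩ ht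
      simp only [samePairs, mem_coe, mem_filter, mem_product, mem_Ioo, mem_sigma,
        mem_range] at ht ⊢
      omega
    · rintro ⟨s, t⟩ ht
      simp only [samePairs, mem_coe, mem_filter, mem_product, mem_Ioo, mem_sigma,
        mem_range] at ht ⊢
      omega
    · rintro ⟨q, r⟩ ht
      simp only [samePairs, mem_coe, mem_filter, mem_product, mem_Ioo] at ht
      simp only [Prod.mk.injEq]; omega
    · rintro ⟨s, t⟩ ht
      simp only [mem_coe, mem_sigma, mem_range] at ht
      simp only [Sigma.mk.injEq, heq_eq_eq]; omega
  rw [h, card_sigma]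
  simp only [card_range]

lemma card_samePairs_odd (K : ℕ) :
    #(samePairs (2 * K + 1)) = ∑ s ∈ range K, (K - (s + 1) - (s + 2) / 2) := by
  have h : #(samePairs (2 * K + 1)) =
      #((range K).sigma fun s => range (K - (s + 1) - (s + 2) / 2)) := by
    refine card_nbij' (fun t => ⟨K - t.2 / 2 - 1, t.1 / 2 - (K - t.2 / 2 + 1) / 2⟩)
      (fun t => (2 * ((t.1 + 2) / 2 + t.2) + 1, 2 * (K - (t.1 + 1)) + 1)) ?_ ?_ ?_ ?_
    · rintro ⟨q, r⟩ ht
      simp only [samePairs, mem_coe, mem_filter, mem_product, mem_Ioo, mem_sigma,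
        mem_range] at ht ⊢
      omega
    · rintro ⟨s, t⟩ ht
      simp only [samePairs, mem_coe, mem_filter, mem_product, mem_Ioo, mem_sigma,
        mem_range] at ht ⊢
      omega
    · rintro ⟨q, r⟩ ht
      simp only [samePairs, mem_coe, mem_filter, mem_product, mem_Ioo] at ht
      simp only [Prod.mk.injEq]; omega
    · rintro ⟨s, t⟩ ht
      simp only [mem_coe, mem_sigma, mem_range] at ht
      simp only [Sigma.mk.injEq, heq_eq_eq]; omega
  rw [h, card_sigma]
  simp only [card_range]

/-- Raising K by 3 and s by 2 leaves the summand unchanged, so only the first two summands are new;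
the last one vanishes by truncation. -/
lemma card_samePairs_even_add_three (K : ℕ) :
    #(samePairs (2 * (K + 1 + 3))) = #(samePairs (2 * (K + 1))) + 2 * (K + 1) := by
  rw [card_samePairs_even, card_samePairs_even, sum_range_succ', sum_range_succ', sum_range_succ,
    sum_congr rfl fun s _ => (by omega : K + 1 + 3 - 1 - (s + 1 + 1 + 1) - (s + 1 + 1 + 1) / 2 =
      K + 1 - 1 - (s + 1) - (s + 1) / 2)]
  omega

lemma card_samePairs_odd_add_three (K : ℕ) :
    #(samePairs (2 * (K + 3) + 1)) = #(samePairs (2 * K + 1)) + (2 * K + 1) := by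
  rw [card_samePairs_odd, card_samePairs_odd, sum_range_succ', sum_range_succ', sum_range_succ,
    sum_congr rfl fun s _ => (by omega : K + 3 - (s + 1 + 1 + 1) - (s + 1 + 1 + 2) / 2 =
      K - (s + 1) - (s + 2) / 2)]
  omega

lemma three_mul_card_samePairs_even : ∀ K : ℕ,
    3 * (#(samePairs (2 * (K + 1))) : ℝ) =
      ((K : ℝ) + 1) ^ 2 - 3 * (K + 1) + 2 + if 3 ∣ K + 1 then 1 else 0
  | 0 => by rw [card_samePairs_even]; norm_num
  | 1 => by rw [card_samePairs_even]; norm_num [sum_range_succ]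
  | 2 => by rw [card_samePairs_even]; norm_num [sum_range_succ]
  | K + 3 => by
    have ih := three_mul_card_samePairs_even K
    rw [show K + 3 + 1 = K + 1 + 3 by ring, card_samePairs_even_add_three]
    rw [if_congr (by omega : 3 ∣ K + 1 + 3 ↔ 3 ∣ K + 1) rfl rfl]
    push_cast
    linear_combination ih

lemma three_mul_card_samePairs_odd : ∀ K : ℕ,
    3 * (#(samePairs (2 * K + 1)) : ℝ) =
      (K : ℝ) ^ 2 - 2 * K + if 3 ∣ 2 * K + 1 then 1 else 0
  | 0 => by rw [card_samePairs_odd]; norm_num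
  | 1 => by rw [card_samePairs_odd]; norm_num
  | 2 => by rw [card_samePairs_odd]; norm_num [sum_range_succ]
  | K + 3 => by
    have ih := three_mul_card_samePairs_odd K
    rw [card_samePairs_odd_add_three]
    rw [if_congr (by omega : 3 ∣ 2 * (K + 3) + 1 ↔ 3 ∣ 2 * K + 1) rfl rfl]
    push_cast
    linear_combination ih

/-! ### Summing the increments -/

/-- The corrections for 3 ∣ M in the linear part and in the triple count cancel: -12 + 36/3 = 0. For
even M the analogue is -20 + 12 = -8. -/
lemma signAvg_energyIncrement_sq_odd (K : ℕ) :
    signAvg (2 * K + 1) (fun x => energyIncrement (2 * K + 1) x ^ 2) = 16 * (K : ℝ) ^ 2 - 8 * K := by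
  have h := three_mul_card_samePairs_odd K
  rw [signAvg_energyIncrement_sq, sum_linCoeff_mul, sum_linCoeff_mul_odd, card_mixedPairs_odd]
  push_cast
  split_ifs at h ⊢ <;> linear_combination 12 * h

lemma signAvg_energyIncrement_sq_even (K : ℕ) :
    signAvg (2 * (K + 1)) (fun x => energyIncrement (2 * (K + 1)) x ^ 2) =
      16 * ((K : ℝ) + 1) ^ 2 - 20 * (K + 1) + 5 - (if 2 ∣ K + 1 then 8 else 0) -
        if 3 ∣ K + 1 then 8 else 0 := by
  have h := three_mul_card_samePairs_even K
  rw [signAvg_energyIncrement_sq, sum_linCoeff_mul, sum_linCoeff_mul_even, card_mixedPairs_even]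
  push_cast
  split_ifs at h ⊢ <;> linear_combination 12 * h

lemma signAvg_centredEnergy_sq_odd (K : ℕ) :
    signAvg (2 * K + 1) (fun x => centredEnergy (2 * K + 1) x ^ 2) =
      (32 * (K : ℝ) ^ 3 - 42 * (K : ℝ) ^ 2 + 13 * K) / 3 - 8 * ((K / 2 : ℕ) : ℝ) - 8 * ((K / 3 : ℕ) : ℝ) := by
  rw [signAvg_centredEnergy_sq]
  induction K with
  | zero => simp
  | succ K ih =>
    rw [show 2 * (K + 1) = 2 * K + 1 + 1 by ring, sum_range_succ, sum_range_succ, ih,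
      signAvg_energyIncrement_sq_odd, show 2 * K + 1 + 1 = 2 * (K + 1) by ring,
      signAvg_energyIncrement_sq_even]
    have h2 : (((K + 1) / 2 : ℕ) : ℝ) = ((K / 2 : ℕ) : ℝ) + if 2 ∣ K + 1 then 1 else 0 := by
      split_ifs
      · rw [show (K + 1) / 2 = K / 2 + 1 by omega]; push_cast; ring
      · rw [show (K + 1) / 2 = K / 2 by omega]; ring
    have h3 : (((K + 1) / 3 : ℕ) : ℝ) = ((K / 3 : ℕ) : ℝ) + if 3 ∣ K + 1 then 1 else 0 := by
      split_ifs
      · rw [show (K + 1) / 3 = K / 3 + 1 by omega]; push_cast; ring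
      · rw [show (K + 1) / 3 = K / 3 by omega]; ring
    rw [h2, h3]
    push_cast
    split_ifs <;> ring

lemma signAvg_centredEnergy_sq_even (K : ℕ) :
    signAvg (2 * K + 2) (fun x => centredEnergy (2 * K + 2) x ^ 2) =
      (32 * (K : ℝ) ^ 3 - 42 * (K : ℝ) ^ 2 + 13 * K) / 3 + 16 * (K : ℝ) ^ 2 - 8 * K -
        8 * ((K / 2 : ℕ) : ℝ) - 8 * ((K / 3 : ℕ) : ℝ) := by
  have h := signAvg_centredEnergy_sq_odd K
  rw [signAvg_centredEnergy_sq] at h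
  rw [show 2 * K + 2 = 2 * K + 1 + 1 by ring, signAvg_centredEnergy_sq, sum_range_succ, h,
    signAvg_energyIncrement_sq_odd]
  ring

/-! ### Skew-symmetric polynomials parametrised by signs -/

/-- The sign `(-1) ^ ⌊t / 2⌋`. -/
def quarterSign (t : ℤ) : ℝ := if t % 4 < 2 then 1 else -1

lemma quarterSign_mul_self (t : ℤ) : quarterSign t * quarterSign t = 1 := by
  unfold quarterSign; split_ifs <;> norm_num

lemma neg_one_pow_eq_ite (k : ℕ) : (-1 : ℝ) ^ k = if k % 2 = 0 then 1 else -1 := by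
  split_ifs with h
  · exact (Nat.even_iff.2 h).neg_one_pow
  · exact (Nat.odd_iff.2 (by omega)).neg_one_pow

lemma quarterSign_eq_neg_one_pow_mul {t u : ℤ} {k : ℕ} (h : t + u = 0) (hk : (2 : ℤ) ∣ t - k) :
    quarterSign t = (-1) ^ k * quarterSign u := by
  rw [neg_one_pow_eq_ite]
  unfold quarterSign
  split_ifs <;> first | (exfalso; omega) | norm_num

/-- For t, u both even the halves add up to v; for both odd the floors add up to v - 1 and (-1)^u
supplies the missing sign. -/
lemma quarterSign_mul_quarterSign {t u v : ℤ} {k l : ℕ} (h : t + u = 2 * v)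
    (hk : (2 : ℤ) ∣ u - k) (hl : (2 : ℤ) ∣ v - l) :
    quarterSign t * quarterSign u * (-1) ^ k = (-1) ^ l := by
  rw [neg_one_pow_eq_ite, neg_one_pow_eq_ite]
  unfold quarterSign
  split_ifs <;> first | (exfalso; omega) | norm_num

/-- The coefficients of the polynomial `skewPoly m x`. -/
def skewCoeff (m : ℕ) (x : ℕ → ℝ) (j : ℕ) : ℝ :=
  if j ≤ 2 * m then quarterSign ((j : ℤ) - m) * x ((j : ℤ) - m).natAbs else 0

/-- The skew-symmetric polynomial of degree at most `2m` attached to `x 0, …, x m`. -/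
noncomputable def skewPoly (m : ℕ) (x : ℕ → ℝ) : ℂ[X] :=
  ∑ j ∈ range (2 * m + 1), C (skewCoeff m x j : ℂ) * X ^ j

lemma coeff_skewPoly (m : ℕ) (x : ℕ → ℝ) (j : ℕ) : (skewPoly m x).coeff j = skewCoeff m x j := by
  simp only [skewPoly, finsetSum_coeff, coeff_C_mul_X_pow]
  rw [sum_ite_eq]
  split_ifs with h
  · rfl
  · rw [skewCoeff, if_neg (by simpa using h)]; simp

lemma skewCoeff_reflect {m : ℕ} (x : ℕ → ℝ) {j : ℕ} (hj : j ≤ 2 * m) :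
    skewCoeff m x j = (-1) ^ (m + j) * skewCoeff m x (2 * m - j) := by
  rw [skewCoeff, skewCoeff, if_pos hj, if_pos (by omega),
    quarterSign_eq_neg_one_pow_mul (u := ((2 * m - j : ℕ) : ℤ) - m) (k := m + j) (by omega) (by omega),
    show (((2 * m - j : ℕ) : ℤ) - m).natAbs = ((j : ℤ) - m).natAbs by omega]
  ring

/-- The right-hand side is the value of a reversed polynomial `g`, and polynomials agreeing at all
nonzero z are equal. -/
lemma eval_eq_neg_inv_iff {m : ℕ} {f : ℂ[X]} (hf : f.natDegree < 2 * m + 1) :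
    (∀ z : ℂ, z ≠ 0 → f.eval z = (-1) ^ m * z ^ (2 * m) * f.eval (-z⁻¹)) ↔
      ∀ j ≤ 2 * m, f.coeff j = (-1) ^ (m + j) * f.coeff (2 * m - j) := by
  let g : ℂ[X] := ∑ j ∈ range (2 * m + 1), C ((-1) ^ (m + j) * f.coeff (2 * m - j)) * X ^ j
  have hg : ∀ z : ℂ, z ≠ 0 → g.eval z = (-1) ^ m * z ^ (2 * m) * f.eval (-z⁻¹) := by
    intro z hz
    rw [eval_eq_sum_range' hf, ← sum_range_reflect, mul_sum, eval_finsetSum]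
    refine sum_congr rfl fun j hj => ?_
    rw [mem_range] at hj
    obtain ⟨k, hk⟩ : ∃ k, 2 * m = j + k := ⟨2 * m - j, by omega⟩
    rw [show 2 * m + 1 - 1 - j = k by omega, show 2 * m - j = k by omega, hk]
    simp only [eval_mul, eval_C, eval_pow, eval_X]
    rw [neg_pow z⁻¹, inv_pow, pow_add z]
    have hz' : z ^ k ≠ 0 := pow_ne_zero _ hz
    have hs : (-1 : ℂ) ^ j = (-1) ^ k := by
      have : (-1 : ℂ) ^ (j + k) = 1 := by rw [← hk]; simp
      have h2 : (-1 : ℂ) ^ k * (-1) ^ k = 1 := by rw [← pow_add]; simp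
      rw [pow_add] at this
      linear_combination (-1 : ℂ) ^ k * this - (-1) ^ j * h2
    rw [pow_add, hs]
    field_simp
  have hgc : ∀ j ≤ 2 * m, g.coeff j = (-1) ^ (m + j) * f.coeff (2 * m - j) := by
    intro j hj
    simp only [g, finsetSum_coeff, coeff_C_mul_X_pow]
    rw [sum_ite_eq, if_pos (mem_range.2 (by omega))]
  constructor
  · intro h j hj
    have : f = g := by
      refine eq_of_infinite_eval_eq f g (Set.Infinite.mono (s := {0}ᶜ) ?_ ?_)
      · intro z hz
        exact (h z hz).trans (hg z hz).symm
      · exact (Set.finite_singleton _).infinite_compl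
    rw [← hgc j hj, ← this]
  · intro h z hz
    have : f = g := by
      ext j
      by_cases hj : j ≤ 2 * m
      · rw [h j hj, hgc j hj]
      · rw [coeff_eq_zero_of_natDegree_lt (by omega)]
        simp only [g, finsetSum_coeff, coeff_C_mul_X_pow]
        rw [sum_ite_eq, if_neg (by rw [mem_range]; omega)]
    rw [← hg z hz, ← this]

lemma skewCoeff_signVec_eq (m : ℕ) (A : Finset ℕ) {j : ℕ} (hj : j ≤ 2 * m) :
    skewCoeff m (signVec A) j = 1 ∨ skewCoeff m (signVec A) j = -1 := by
  rw [skewCoeff, if_pos hj]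
  unfold quarterSign signVec
  split_ifs <;> norm_num

lemma natDegree_skewPoly (m : ℕ) (A : Finset ℕ) : (skewPoly m (signVec A)).natDegree = 2 * m := by
  refine natDegree_eq_of_le_of_coeff_ne_zero ?_ ?_
  · rw [natDegree_le_iff_coeff_eq_zero]
    intro j hj
    rw [coeff_skewPoly, skewCoeff, if_neg (by omega)]; simp
  · rw [coeff_skewPoly]
    rcases skewCoeff_signVec_eq m A le_rfl with h | h <;> rw [h] <;> simp

lemma skewPoly_mem (m : ℕ) (A : Finset ℕ) :
    skewPoly m (signVec A) ∈ skewSymmetricSet (2 * m + 1) := by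
  refine ⟨⟨by rw [natDegree_skewPoly], fun j hj => ?_⟩, ⟨m, rfl⟩, ?_⟩
  · rw [coeff_skewPoly]
    rcases skewCoeff_signVec_eq m A (show j ≤ 2 * m by omega) with h | h <;> rw [h] <;> simp
  · rw [show (2 * m + 1 - 1) / 2 = m by omega, Nat.add_sub_cancel]
    rw [eval_eq_neg_inv_iff (by rw [natDegree_skewPoly]; omega)]
    intro j hj
    rw [coeff_skewPoly, coeff_skewPoly, skewCoeff_reflect _ hj]
    push_cast; ring

lemma exists_skewPoly_eq {m : ℕ} {f : ℂ[X]} (hf : f ∈ skewSymmetricSet (2 * m + 1)) :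
    ∃ A ⊆ range (m + 1), skewPoly m (signVec A) = f := by
  classical
  obtain ⟨⟨hdeg, hc⟩, -, hskew⟩ := hf
  rw [show (2 * m + 1 - 1) / 2 = m by omega, Nat.add_sub_cancel,
    eval_eq_neg_inv_iff (by omega)] at hskew
  -- The upper half of the coefficients dictates the signs: -1 exactly where f deviates from
  -- `quarterSign`. Reflection then settles the lower half.
  have hup : ∀ j ≤ m, f.coeff (m + j) = skewCoeff m
      (signVec {j ∈ range (m + 1) | f.coeff (m + j) ≠ quarterSign j}) (m + j) := by
    intro j hj
    rw [skewCoeff, if_pos (by omega), show (((m + j : ℕ) : ℤ) - m) = j by omega, Int.natAbs_natCast,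
      signVec]
    by_cases h : f.coeff (m + j) = quarterSign j
    · rw [if_neg (by simp [h]), h]; simp
    · rw [if_pos (by simp only [mem_filter, mem_range]; exact ⟨by omega, h⟩)]
      unfold quarterSign at h ⊢
      rcases hc (m + j) (by omega) with h1 | h1 <;> rw [h1] at h ⊢ <;> split_ifs at h ⊢ <;>
        first | (norm_num; done) | exact absurd (by norm_num) h
  refine ⟨{j ∈ range (m + 1) | f.coeff (m + j) ≠ quarterSign j}, filter_subset _ _, ?_⟩
  ext j
  rw [coeff_skewPoly]
  by_cases hj : j ≤ 2 * m
  · by_cases hjm : m ≤ j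
    · obtain ⟨k, rfl⟩ := Nat.exists_eq_add_of_le hjm
      rw [hup k (by omega)]
    · rw [hskew j hj, skewCoeff_reflect _ hj, show 2 * m - j = m + (m - j) by omega,
        hup (m - j) (by omega)]
      push_cast; ring
  · rw [coeff_eq_zero_of_natDegree_lt (by omega), skewCoeff, if_neg hj]; simp

lemma skewPoly_injOn (m : ℕ) :
    Set.InjOn (fun A => skewPoly m (signVec A)) ((range (m + 1)).powerset : Set (Finset ℕ)) := by
  intro A hA B hB h
  have h' : ∀ j, j ≤ m → signVec A j = signVec B j := by
    intro j hj
    have h1 := congrArg (fun f => f.coeff (m + j)) h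
    simp only [coeff_skewPoly, Complex.ofReal_inj] at h1
    rw [skewCoeff, skewCoeff, if_pos (by omega), if_pos (by omega),
      show (((m + j : ℕ) : ℤ) - m) = j by omega, Int.natAbs_natCast] at h1
    have h2 := quarterSign_mul_self j
    linear_combination quarterSign j * h1 - (signVec A j - signVec B j) * h2
  simp only [coe_powerset, Set.mem_preimage, Set.mem_powerset_iff, coe_subset] at hA hB
  ext j
  by_cases hj : j ≤ m
  · have := h' j hj
    unfold signVec at this
    split_ifs at this with a b b
    · exact iff_of_true a b
    · norm_num at this
    · norm_num at this
    · exact iff_of_false a b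
  · exact iff_of_false (fun h => hj (by have := mem_range.1 (hA h); omega))
      (fun h => hj (by have := mem_range.1 (hB h); omega))

lemma skewSymmetricSet_eq (m : ℕ) : skewSymmetricSet (2 * m + 1) =
    (fun A => skewPoly m (signVec A)) '' ((range (m + 1)).powerset : Set (Finset ℕ)) := by
  ext f
  constructor
  · intro hf
    obtain ⟨A, hA, rfl⟩ := exists_skewPoly_eq hf
    exact ⟨A, mem_coe.2 (mem_powerset.2 hA), rfl⟩
  · rintro ⟨A, -, rfl⟩
    exact skewPoly_mem m A

/-! ### The uniform measure as an average over signs -/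

lemma finite_skewSymmetricSet (m : ℕ) : (skewSymmetricSet (2 * m + 1)).Finite := by
  rw [skewSymmetricSet_eq]; exact (finite_toSet _).image _

lemma isProbabilityMeasure_skewUniform (m : ℕ) :
    IsProbabilityMeasure (skewUniform (2 * m + 1)) :=
  have : MeasurableSingletonClass ℂ[X] := ⟨fun _ => trivial⟩
  isProbabilityMeasure_uniformOn (finite_skewSymmetricSet m) ⟨_, skewPoly_mem m ∅⟩

lemma ae_mem_skewSymmetricSet (m : ℕ) :
    ∀ᵐ f ∂(skewUniform (2 * m + 1)), f ∈ skewSymmetricSet (2 * m + 1) :=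
  ae_cond_mem trivial

lemma memLp_skewUniform (m : ℕ) (g : ℂ[X] → ℝ) (p : ENNReal) :
    MemLp g p (skewUniform (2 * m + 1)) := by
  have := isProbabilityMeasure_skewUniform m
  have hg : Measurable g := fun _ _ => trivial
  obtain ⟨C, hC⟩ := ((finite_skewSymmetricSet m).image fun f => ‖g f‖).bddAbove
  refine MemLp.of_bound hg.aestronglyMeasurable C ?_
  filter_upwards [ae_mem_skewSymmetricSet m] with f hf
  exact hC ⟨f, hf, rfl⟩

lemma integral_skewUniform (m : ℕ) (g : ℂ[X] → ℝ) :
    ∫ f, g f ∂(skewUniform (2 * m + 1)) = signAvg (m + 1) fun x => g (skewPoly m x) := by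
  classical
  have : MeasurableSingletonClass ℂ[X] := ⟨fun _ => trivial⟩
  have hS : skewSymmetricSet (2 * m + 1) =
      (((range (m + 1)).powerset.image fun A => skewPoly m (signVec A) : Finset ℂ[X]) :
        Set ℂ[X]) := by
    rw [coe_image, skewSymmetricSet_eq]
  have hg : Measurable g := fun _ _ => trivial
  rw [skewUniform, hS, uniformOn, ProbabilityTheory.cond, integral_smul_measure, setIntegral_finset,
    sum_image (skewPoly_injOn m), Measure.count_apply_finset, card_image_of_injOn (skewPoly_injOn m),
    signAvg]
  · simp
  · rw [← Set.biUnion_of_singleton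
        (((range (m + 1)).powerset.image fun A => skewPoly m (signVec A) : Finset ℂ[X]) :
        Set ℂ[X])]
    exact integrableOn_finset_iUnion.2 fun f _ => integrableOn_singleton (hx := by simp)

/-! ### The fourth power of the norm as an energy -/

/-- The sum of `x |t| * x |2v - t|` over the integers `t` with `|t| ≤ m` and `|2v - t| ≤ m`. -/
noncomputable def symmCorr (m : ℕ) (x : ℕ → ℝ) (v : ℤ) : ℝ :=
  ∑ t ∈ Icc (-m : ℤ) m with (2 * v - t).natAbs ≤ m, x t.natAbs * x (2 * v - t).natAbs

lemma symmCorr_neg (m : ℕ) (x : ℕ → ℝ) (v : ℤ) : symmCorr m x (-v) = symmCorr m x v := by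
  unfold symmCorr
  refine sum_nbij' (fun t => -t) (fun t => -t) ?_ ?_ ?_ ?_ ?_
  all_goals
    simp only [mem_filter, mem_Icc]
    intro t ht
  · omega
  · omega
  · omega
  · omega
  · rw [Int.natAbs_neg, show (2 * -v - t).natAbs = (2 * v - -t).natAbs by omega]

lemma symmCorr_zero (m : ℕ) {x : ℕ → ℝ} (hx : ∀ j, x j * x j = 1) :
    symmCorr m x 0 = 2 * m + 1 := by
  unfold symmCorr
  have h1 : (Icc (-m : ℤ) m).filter (fun t => (2 * 0 - t).natAbs ≤ m) = Icc (-m : ℤ) m := by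
    refine filter_true_of_mem fun t ht => ?_
    rw [mem_Icc] at ht; omega
  have h2 : ∀ t ∈ Icc (-m : ℤ) m, x t.natAbs * x (2 * 0 - t).natAbs = 1 := by
    intro t _
    rw [show (2 * 0 - t).natAbs = t.natAbs by omega, hx]
  rw [h1, sum_congr rfl h2, sum_const, Int.card_Icc, show ((m : ℤ) + 1 - -m).toNat = 2 * m + 1 by omega]
  simp

/-- The reflection t ↦ 2v - t fixes t = v, which contributes 1, and exchanges t > v with t < v. -/
lemma symmCorr_pos {m v : ℕ} (hv : 0 < v) (hvm : v ≤ m) {x : ℕ → ℝ} (hx : ∀ j, x j * x j = 1) :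
    symmCorr m x v = 1 + 2 * pairSum (m + 1) v x := by
  unfold symmCorr
  have h1 : (Icc (-m : ℤ) m).filter (fun t => (2 * (v : ℤ) - t).natAbs ≤ m) =
      insert (v : ℤ) (Ioc (v : ℤ) m ∪ Ico (2 * (v : ℤ) - m) v) := by
    ext t; simp only [mem_filter, mem_Icc, mem_insert, mem_union, mem_Ioc, mem_Ico]; omega
  have h2 : ∑ t ∈ Ioc (v : ℤ) m, x t.natAbs * x (2 * (v : ℤ) - t).natAbs = pairSum (m + 1) v x := by
    unfold pairSum
    refine sum_nbij' (fun t => t.natAbs) (fun t => (t : ℤ)) ?_ ?_ ?_ ?_ ?_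
    all_goals
      simp only [mem_Ioc, mem_Ioo]
      intro t ht
    · omega
    · omega
    · omega
    · omega
    · rw [show ((t.natAbs : ℕ) : ℤ) = t by omega]
  have h3 : ∑ t ∈ Ico (2 * (v : ℤ) - m) v, x t.natAbs * x (2 * (v : ℤ) - t).natAbs =
      pairSum (m + 1) v x := by
    unfold pairSum
    refine sum_nbij' (fun t => (2 * v - t).natAbs) (fun t => 2 * (v : ℤ) - t) ?_ ?_ ?_ ?_ ?_
    all_goals
      simp only [mem_Ico, mem_Ioo]
      intro t ht
    · omega
    · omega
    · omega
    · omega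
    · rw [show 2 * (v : ℤ) - ((2 * (v : ℤ) - t).natAbs : ℕ) = t by omega, mul_comm]
  rw [h1, sum_insert, sum_union, h2, h3, show 2 * (v : ℤ) - v = v by ring, hx]
  · ring
  · rw [disjoint_left]; intro t; simp only [mem_Ioc, mem_Ico]; omega
  · simp only [mem_union, mem_Ioc, mem_Ico]; omega

lemma sum_symmCorr_sq (m : ℕ) {x : ℕ → ℝ} (hx : ∀ j, x j * x j = 1) :
    ∑ r ∈ range (2 * m + 1), symmCorr m x ((r : ℤ) - m) ^ 2 =
      8 * (m : ℝ) ^ 2 + 2 * m + 1 + 8 * centredEnergy (m + 1) x := by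
  have h1 : ∑ r ∈ range (2 * m + 1), symmCorr m x ((r : ℤ) - m) ^ 2 =
      (2 * m + 1) ^ 2 + 2 * ∑ v ∈ Ioo 0 (m + 1), (1 + 2 * pairSum (m + 1) v x) ^ 2 := by
    have hs : range (2 * m + 1) = insert m (Ioo m (2 * m + 1) ∪ range m) := by
      ext r; simp only [mem_insert, mem_union, mem_Ioo, mem_range]; omega
    have ha : ∑ r ∈ Ioo m (2 * m + 1), symmCorr m x ((r : ℤ) - m) ^ 2 =
        ∑ v ∈ Ioo 0 (m + 1), (1 + 2 * pairSum (m + 1) v x) ^ 2 := by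
      refine sum_nbij' (fun r => r - m) (fun v => m + v) ?_ ?_ ?_ ?_ ?_
      all_goals
        simp only [mem_Ioo]
        intro r hr
      · omega
      · omega
      · omega
      · omega
      · rw [← symmCorr_pos (by omega) (by omega) hx, show ((r - m : ℕ) : ℤ) = (r : ℤ) - m by omega]
    have hb : ∑ r ∈ range m, symmCorr m x ((r : ℤ) - m) ^ 2 =
        ∑ v ∈ Ioo 0 (m + 1), (1 + 2 * pairSum (m + 1) v x) ^ 2 := by
      refine sum_nbij' (fun r => m - r) (fun v => m - v) ?_ ?_ ?_ ?_ ?_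
      all_goals
        simp only [mem_Ioo, mem_range]
        intro r hr
      · omega
      · omega
      · omega
      · omega
      · rw [← symmCorr_pos (by omega) (by omega) hx, ← symmCorr_neg,
          show ((m - r : ℕ) : ℤ) = -((r : ℤ) - m) by omega]
    rw [hs, sum_insert, sum_union, ha, hb, sub_self, symmCorr_zero m hx]
    · ring
    · rw [disjoint_left]; intro t; simp only [mem_Ioo, mem_range]; omega
    · simp only [mem_union, mem_Ioo, mem_range]; omega
  have h2 : ∑ v ∈ Ioo 0 (m + 1), (1 + 2 * pairSum (m + 1) v x) ^ 2 =
      4 * centredEnergy (m + 1) x + ∑ v ∈ Ioo 0 (m + 1), (1 + 4 * ((m : ℝ) - v)) := by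
    rw [centredEnergy, mul_sum, ← sum_add_distrib]
    refine sum_congr rfl fun v _ => ?_
    push_cast; ring
  -- The upper limit k is separated from the m inside the summand to allow induction.
  have h3 : ∀ k : ℕ, ∑ v ∈ Ioo 0 (k + 1), (1 + 4 * ((m : ℝ) - v)) =
      (4 * m + 1) * k - 2 * k * (k + 1) := by
    intro k
    induction k with
    | zero =>
      have : Ioo 0 (0 + 1) = (∅ : Finset ℕ) := by decide
      rw [this]; simp
    | succ k ih =>
      have : Ioo 0 (k + 1 + 1) = insert (k + 1) (Ioo 0 (k + 1)) := by
        ext v; simp only [mem_Ioo, mem_insert]; omega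
      rw [this, sum_insert (by simp), ih]
      push_cast; ring
  rw [h1, h2, h3]
  ring

/-- The coefficients of `f(z) f(-z)` where `f = skewPoly m x`. -/
lemma coeff_skewPoly_mul_comp_neg (m : ℕ) (x : ℕ → ℝ) (p : ℕ) :
    (skewPoly m x * (skewPoly m x).comp (-X)).coeff p =
      ((∑ t ∈ antidiagonal p, skewCoeff m x t.1 * skewCoeff m x t.2 * (-1) ^ t.2 : ℝ) : ℂ) := by
  rw [coeff_mul, Complex.ofReal_sum]
  refine sum_congr rfl fun t _ => ?_
  rw [show (-X : ℂ[X]) = C (-1) * X by simp, comp_C_mul_X_coeff, coeff_skewPoly, coeff_skewPoly]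
  push_cast; ring

/-- Swapping the two factors reverses the sign of each term when p is odd. -/
lemma sum_antidiagonal_skewCoeff_odd (m : ℕ) (x : ℕ → ℝ) {p : ℕ} (hp : p % 2 = 1) :
    ∑ t ∈ antidiagonal p, skewCoeff m x t.1 * skewCoeff m x t.2 * (-1) ^ t.2 = 0 := by
  have h := Nat.sum_antidiagonal_swap (n := p)
    (f := fun t : ℕ × ℕ => skewCoeff m x t.1 * skewCoeff m x t.2 * (-1) ^ t.2)
  have h2 : ∑ t ∈ antidiagonal p, skewCoeff m x t.swap.1 * skewCoeff m x t.swap.2 * (-1) ^ t.swap.2 =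
      -∑ t ∈ antidiagonal p, skewCoeff m x t.1 * skewCoeff m x t.2 * (-1) ^ t.2 := by
    rw [← sum_neg_distrib]
    refine sum_congr rfl fun t ht => ?_
    rw [HasAntidiagonal.mem_antidiagonal] at ht
    have : (-1 : ℝ) ^ t.1 = -(-1) ^ t.2 := by
      rw [neg_one_pow_eq_ite, neg_one_pow_eq_ite]
      split_ifs <;> first | (exfalso; omega) | norm_num
    simp only [Prod.fst_swap, Prod.snd_swap]
    rw [this]; ring
  linarith

lemma sq_sum_antidiagonal_skewCoeff_even (m : ℕ) (x : ℕ → ℝ) (r : ℕ) :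
    (∑ t ∈ antidiagonal (2 * r), skewCoeff m x t.1 * skewCoeff m x t.2 * (-1) ^ t.2) ^ 2 =
      symmCorr m x ((r : ℤ) - m) ^ 2 := by
  have h : ∑ t ∈ antidiagonal (2 * r), skewCoeff m x t.1 * skewCoeff m x t.2 * (-1) ^ t.2 =
      (-1) ^ r * symmCorr m x ((r : ℤ) - m) := by
    have h1 : ∑ t ∈ antidiagonal (2 * r), skewCoeff m x t.1 * skewCoeff m x t.2 * (-1) ^ t.2 =
        ∑ t ∈ antidiagonal (2 * r) with t.1 ≤ 2 * m ∧ t.2 ≤ 2 * m,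
          skewCoeff m x t.1 * skewCoeff m x t.2 * (-1) ^ t.2 := by
      refine (sum_subset (filter_subset _ _) fun t ht hn => ?_).symm
      simp only [mem_filter, not_and] at hn
      by_cases h1 : t.1 ≤ 2 * m
      · rw [skewCoeff, skewCoeff, if_neg (hn ht h1)]; simp
      · rw [skewCoeff, if_neg h1]; simp
    rw [h1, symmCorr, mul_sum]
    refine sum_nbij' (fun t => (t.1 : ℤ) - m)
      (fun t => ((t + m).toNat, (2 * (r : ℤ) - m - t).toNat)) ?_ ?_ ?_ ?_ ?_
    · rintro ⟨i, j⟩ ht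
      simp only [mem_filter, HasAntidiagonal.mem_antidiagonal, mem_Icc] at ht ⊢
      omega
    · intro t ht
      simp only [mem_filter, HasAntidiagonal.mem_antidiagonal, mem_Icc] at ht ⊢
      omega
    · rintro ⟨i, j⟩ ht
      simp only [mem_filter, HasAntidiagonal.mem_antidiagonal] at ht
      simp only [Prod.mk.injEq]
      omega
    · intro t ht
      simp only [mem_filter, mem_Icc] at ht
      simp only
      omega
    · rintro ⟨i, j⟩ ht
      simp only [mem_filter, HasAntidiagonal.mem_antidiagonal] at ht
      -- The exponents j + m and r + m stand in for j - m and r - m, which have the same parity but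
      -- may be negative.
      have hq : quarterSign ((i : ℤ) - m) * quarterSign ((j : ℤ) - m) * (-1) ^ (j + m) =
          (-1) ^ (r + m) :=
        quarterSign_mul_quarterSign (v := (r : ℤ) - m) (by omega) (by omega) (by omega)
      have hm : ((-1 : ℝ) ^ m) * (-1) ^ m = 1 := by rw [← pow_add]; simp
      rw [pow_add, pow_add] at hq
      simp only
      rw [skewCoeff, skewCoeff, if_pos ht.2.1, if_pos ht.2.2,
        show (2 * ((r : ℤ) - m) - ((i : ℤ) - m)).natAbs = ((j : ℤ) - m).natAbs by omega]
      have hq' : quarterSign ((i : ℤ) - m) * quarterSign ((j : ℤ) - m) * (-1) ^ j = (-1) ^ r := by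
        linear_combination (-1 : ℝ) ^ m * hq + ((-1) ^ r -
          quarterSign ((i : ℤ) - m) * quarterSign ((j : ℤ) - m) * (-1) ^ j) * hm
      linear_combination x ((i : ℤ) - m).natAbs * x ((j : ℤ) - m).natAbs * hq'
  rw [h, mul_pow, ← pow_mul, mul_comm r, pow_mul]
  norm_num

/-- The coefficients are real, so f(-1/z) is the conjugate of f(-z) on the unit circle; the
functional equation does the rest. -/
lemma norm_eval_neg_of_skew {m : ℕ} (x : ℕ → ℝ) {z : ℂ} (hz : ‖z‖ = 1) :
    ‖(skewPoly m x).eval (-z)‖ = ‖(skewPoly m x).eval z‖ := by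
  have hz0 : z ≠ 0 := by rintro rfl; simp at hz
  have hdeg : (skewPoly m x).natDegree < 2 * m + 1 := by
    rw [Nat.lt_succ_iff, natDegree_le_iff_coeff_eq_zero]
    intro j hj
    rw [coeff_skewPoly, skewCoeff, if_neg (by omega)]; simp
  have h := (eval_eq_neg_inv_iff hdeg).2 (fun j hj => by
    rw [coeff_skewPoly, coeff_skewPoly, skewCoeff_reflect _ hj]; push_cast; ring) z hz0
  have hconj : (skewPoly m x).eval (-z⁻¹) = (starRingEnd ℂ) ((skewPoly m x).eval (-z)) := by
    rw [Complex.inv_eq_conj hz]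
    simp only [skewPoly, eval_finsetSum, eval_mul, eval_C, eval_pow, eval_X, map_sum, map_mul,
      Complex.conj_ofReal, map_pow, map_neg]
  rw [h, hconj]
  simp [hz]

lemma circleNorm_four_pow_skewPoly (m : ℕ) {x : ℕ → ℝ} (hx : ∀ j, x j * x j = 1) :
    circleNorm 4 (skewPoly m x) ^ 4 = 8 * (m : ℝ) ^ 2 + 2 * m + 1 + 8 * centredEnergy (m + 1) x := by
  have hnn : 0 ≤ (2 * Real.pi)⁻¹ * ∫ θ in (0 : ℝ)..(2 * Real.pi),
      ‖(skewPoly m x).eval (Complex.exp (Complex.I * θ))‖ ^ (4 : ℝ) := by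
    refine mul_nonneg (by positivity) (intervalIntegral.integral_nonneg (by positivity) ?_)
    intro θ _
    positivity
  have h1 : circleNorm 4 (skewPoly m x) ^ 4 = (2 * Real.pi)⁻¹ * ∫ θ in (0 : ℝ)..(2 * Real.pi),
      ‖(skewPoly m x).eval (Complex.exp (Complex.I * θ))‖ ^ (4 : ℝ) := by
    rw [circleNorm, ← Real.rpow_natCast, ← Real.rpow_mul hnn]
    norm_num
  -- Parseval for f(z)f(-z), whose squared modulus on the circle is |f(z)|^4.
  have h2 := sum_sq_norm_coeff_eq_circleAverage (skewPoly m x * (skewPoly m x).comp (-X))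
  have h3 : Real.circleAverage
      (fun z => ‖(skewPoly m x * (skewPoly m x).comp (-X)).eval z‖ ^ 2) 0 1 =
      circleNorm 4 (skewPoly m x) ^ 4 := by
    rw [h1, Real.circleAverage, smul_eq_mul]
    congr 1
    refine intervalIntegral.integral_congr fun θ _ => ?_
    have hz : circleMap 0 1 θ = Complex.exp (Complex.I * θ) := by
      simp [circleMap, mul_comm]
    have hn : ‖Complex.exp (Complex.I * θ)‖ = 1 := by
      rw [mul_comm, Complex.norm_exp_ofReal_mul_I]
    simp only [hz, eval_mul, eval_comp, eval_neg, eval_X, norm_mul, norm_eval_neg_of_skew x hn]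
    rw [show (4 : ℝ) = ((4 : ℕ) : ℝ) by norm_num, Real.rpow_natCast]
    ring
  have h4 : ∀ p, ‖(skewPoly m x * (skewPoly m x).comp (-X)).coeff p‖ ^ 2 =
      (∑ t ∈ antidiagonal p, skewCoeff m x t.1 * skewCoeff m x t.2 * (-1) ^ t.2) ^ 2 := by
    intro p
    rw [coeff_skewPoly_mul_comp_neg, Complex.norm_real, Real.norm_eq_abs, sq_abs]
  have h5 : ∑ p ∈ (skewPoly m x * (skewPoly m x).comp (-X)).support,
      ‖(skewPoly m x * (skewPoly m x).comp (-X)).coeff p‖ ^ 2 =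
      ∑ r ∈ range (2 * m + 1), symmCorr m x ((r : ℤ) - m) ^ 2 := by
    have hinj : Set.InjOn (fun r : ℕ => 2 * r) (range (2 * m + 1)) := by
      intro a _ b _ h; simpa using h
    rw [← sum_congr rfl fun r _ => (sq_sum_antidiagonal_skewCoeff_even m x r),
      ← sum_congr rfl fun r _ => h4 (2 * r),
      ← sum_image (f := fun p => ‖(skewPoly m x * (skewPoly m x).comp (-X)).coeff p‖ ^ 2) hinj]
    refine sum_subset ?_ ?_
    · intro p hp
      rw [mem_support_iff] at hp
      have hpe : p % 2 = 0 := by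
        by_contra h
        rw [coeff_skewPoly_mul_comp_neg, sum_antidiagonal_skewCoeff_odd m x (by omega)] at hp
        simp at hp
      have hple : p ≤ 4 * m := by
        by_contra h
        apply hp
        rw [coeff_skewPoly_mul_comp_neg, sum_eq_zero]
        · simp
        · intro t ht
          rw [HasAntidiagonal.mem_antidiagonal] at ht
          by_cases h1 : t.1 ≤ 2 * m
          · rw [skewCoeff, skewCoeff, if_neg (show ¬ t.2 ≤ 2 * m by omega)]; simp
          · rw [skewCoeff, if_neg h1]; simp
      rw [mem_image]
      exact ⟨p / 2, by rw [mem_range]; omega, by omega⟩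
    · intro p _ hp
      rw [notMem_support_iff.1 hp]; simp
  rw [← h3, ← h2, h5, sum_symmCorr_sq m hx]

/-! ### Mean and variance -/

lemma floor_sub_one_div (m : ℕ) {c : ℕ} (hc : 0 < c) {d : ℝ} (hd : d = 2 * c) :
    (⌊(((2 * m + 1 : ℕ) : ℝ) - 1) / d⌋ : ℝ) = ((m / c : ℕ) : ℝ) := by
  rw [← Int.cast_natCast (R := ℝ) (m / c), Int.cast_inj]
  have hc' : (0 : ℝ) < c := by exact_mod_cast hc
  rw [hd, show (((2 * m + 1 : ℕ) : ℝ) - 1) / (2 * c) = (m : ℝ) / c by push_cast; field_simp; ring,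
    Int.floor_eq_iff]
  have h1 : ((m / c : ℕ) : ℝ) * c ≤ m := by exact_mod_cast Nat.div_mul_le_self m c
  have h2 : (m : ℝ) < (((m / c : ℕ) : ℝ) + 1) * c := by
    have h3 : m < (m / c + 1) * c := by rw [mul_comm]; exact Nat.lt_mul_div_succ m hc
    exact_mod_cast h3
  push_cast
  exact ⟨(le_div_iff₀ hc').2 h1, (div_lt_iff₀ hc').2 h2⟩

lemma integral_circleNorm_four_pow (m : ℕ) :
    ∫ f, circleNorm 4 f ^ 4 ∂(skewUniform (2 * m + 1)) = 8 * (m : ℝ) ^ 2 + 2 * m + 1 := by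
  rw [integral_skewUniform, signAvg_congr
    (F' := fun x => 8 * (m : ℝ) ^ 2 + 2 * m + 1 + 8 * centredEnergy (m + 1) x)
    fun A _ => circleNorm_four_pow_skewPoly m (signVec_mul_self A), signAvg_add, signAvg_const, signAvg_const_mul,
    signAvg_centredEnergy]
  ring

lemma variance_circleNorm_four_pow (m : ℕ) :
    variance (fun f : ℂ[X] => circleNorm 4 f ^ 4) (skewUniform (2 * m + 1)) =
      64 * signAvg (m + 1) (fun x => centredEnergy (m + 1) x ^ 2) := by
  rw [variance_eq_integral (memLp_skewUniform m _ 2).aemeasurable, integral_circleNorm_four_pow,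
    integral_skewUniform, ← signAvg_const_mul]
  refine signAvg_congr fun A _ => ?_
  rw [circleNorm_four_pow_skewPoly m (signVec_mul_self A)]
  ring

end Littlewood


theorem theorem2 (n : ℕ) (hn : Odd n) :
    IsProbabilityMeasure (Littlewood.skewUniform n) ∧
    MemLp (fun f : ℂ[X] => Littlewood.circleNorm 4 f ^ 4) 2 (Littlewood.skewUniform n) ∧
    ∫ f, Littlewood.circleNorm 4 f ^ 4 ∂(Littlewood.skewUniform n)
      = 2 * (n : ℝ) ^ 2 - 3 * (n : ℝ) + 2 ∧
    variance (fun f : ℂ[X] => Littlewood.circleNorm 4 f ^ 4) (Littlewood.skewUniform n)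
      = 32 / 3 * (n : ℝ) ^ 3 - 88 * (n : ℝ) ^ 2 + 592 / 3 * (n : ℝ)
        - 512 * (⌊((n : ℝ) - 1) / 8⌋ : ℝ) - 512 * (⌊((n : ℝ) - 1) / 12⌋ : ℝ) - 88
        + 16 * (-1 : ℝ) ^ ((n - 1) / 2) * ((n : ℝ) - 3) := by
  obtain ⟨m, rfl⟩ := hn
  refine ⟨Littlewood.isProbabilityMeasure_skewUniform m, Littlewood.memLp_skewUniform m _ 2, ?_, ?_⟩
  · rw [Littlewood.integral_circleNorm_four_pow]
    push_cast; ring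
  · rw [Littlewood.variance_circleNorm_four_pow, show (2 * m + 1 - 1) / 2 = m by omega,
      Littlewood.floor_sub_one_div m (c := 4) (by norm_num) (by norm_num),
      Littlewood.floor_sub_one_div m (c := 6) (by norm_num) (by norm_num)]
    -- The parity of m selects the closed form and the value of (-1)^m; the floors of m/4 and m/6
    -- become those of K/2 and K/3.
    obtain ⟨K, rfl | rfl⟩ := Nat.even_or_odd' m
    · rw [Littlewood.signAvg_centredEnergy_sq_odd, show 2 * K / 4 = K / 2 by omega,
        show 2 * K / 6 = K / 3 by omega, pow_mul]
      push_cast; ring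
    · rw [Littlewood.signAvg_centredEnergy_sq_even, show (2 * K + 1) / 4 = K / 2 by omega,
        show (2 * K + 1) / 6 = K / 3 by omega, pow_succ (-1 : ℝ), pow_mul]
      push_cast; ring
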